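/- Theorem (Non-commutative Stone duality). The category of Boolean inverse semigroups and callitic morphisms is dually equivalent to the category of Boolean groupoids and coherent, continuous covering functors. More precisely, $S \mapsto \mathsf{G}(S)$, $\theta \mapsto \theta^{-1}$ and $G \mapsto \mathsf{KB}(G)$, $\phi \mapsto \phi^{-1}$ (both defined below) are contravariant functors between these categories, and they form, up to natural isomorphism, the two functors of a dual equivalence. Here the following terminology is used. In an inverse semigroup, $a \le b$ denotes the natural partial order ($a = be$ for some idempotent $e$), and $a \sim b$ (compatibility) means that $a^{-1}b$ and $ab^{-1}$ are idempotents. A *Boolean inverse semigroup* is an inverse semigroup with zero in which every compatible pair $a \sim b$ has a join $a \vee b$, in which multiplication distributes over such joins, and whose lattice of idempotents is a generalized Boolean algebra. A *morphism* $\theta \colon S \to T$ of Boolean inverse semigroups is a semigroup homomorphism that preserves $0$ and binary compatible joins. It is *callitic* if it is *proper* (each $t \in T$ can be written $t = \bigvee_{i=1}^{n} t_i$ where each $t_i \le \theta(s_i)$ for some $s_i \in S$) and *weakly-meet-preserving* (if $t \le \theta(a), \theta(b)$ then there is $c \le a, b$ such that $t \le \theta(c)$). For an arrow $g$ of a groupoid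 put $\mathbf{d}(g) = g^{-1}g$ and $\mathbf{r}(g) = gg^{-1}$; the product $gh$ is defined exactly when $\mathbf{d}(g) = \mathbf{r}(h)$. A *Boolean groupoid* is a topological groupoid $G$ (multiplication and inversion are continuous) that is étale ($\mathbf{d} \colon G \to G$ is a local homeomorphism) and whose space of identities, with the subspace topology, is a locally compact Boolean space, that is, Hausdorff, locally compact and zero-dimensional; $G$ itself need not be Hausdorff. A *covering functor* $\phi \colon G \to H$ is a functor that restricts, for every identity $e$ of $G$, to a bijection from $\{g : \mathbf{d}(g) = e\}$ to $\{h : \mathbf{d}(h) = \phi(e)\}$. A continuous map is *coherent* if inverse images of compact-open sets are compact-open. A *prime filter* of $S$ is a non-empty, downwardly directed, upwardly closed subset $A$ with $0 \notin A$ such that $a \vee b \in A$ with $a \sim b$ implies $a \in A$ or $b \in A$. The *Stone groupoid* $\mathsf{G}(S)$ is the set of prime filters of $S$, with $\mathbf{d}(A) = (A^{-1}A)^{\uparrow}$, $\mathbf{r}(A) = (AA^{-1})^{\uparrow}$, inverse $A^{-1}$, product $A \cdot B = (AB)^{\uparrow}$ when $\mathbf{d}(A) = \mathbf{r}(B)$,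 and the topology with base the sets $\{A : a \in A\}$, $a \in S$; a callitic morphism $\theta \colon S \to T$ is sent to $\mathsf{G}(T) \to \mathsf{G}(S)$, $A \mapsto \theta^{-1}(A)$. $\mathsf{KB}(G)$ is the set of compact-open local bisections of $G$ (compact-open $U \subseteq G$ such that $U^{-1}U$ and $UU^{-1}$ consist of identities) under subset multiplication; a coherent, continuous covering functor $\phi \colon G \to H$ is sent to $\mathsf{KB}(H) \to \mathsf{KB}(G)$, $U \mapsto \phi^{-1}(U)$. -/

import Mathlib

open CategoryTheory

universe u

namespace NCStone

/-! ## Inverse semigroups -/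

/-- An inverse semigroup: every element has exactly one (generalized) inverse. -/
class InverseSemigroup (S : Type u) extends Semigroup S, Inv S where
  mul_inv_mul : ∀ a : S, a * a⁻¹ * a = a
  inv_mul_inv : ∀ a : S, a⁻¹ * a * a⁻¹ = a⁻¹
  inv_unique : ∀ a b : S, a * b * a = a → b * a * b = b → b = a⁻¹

namespace InverseSemigroup

variable {S : Type u} [InverseSemigroup S]

theorem inv_of_idem {e : S} (he : IsIdempotentElem e) : e⁻¹ = e :=
  (inv_unique e e (by rw [he.eq, he.eq]) (by rw [he.eq, he.eq])).symm

theorem inv_inv' (a : S) : a⁻¹⁻¹ = a :=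
  (inv_unique a⁻¹ a (inv_mul_inv a) (mul_inv_mul a)).symm

theorem idem_inv_mul (a : S) : IsIdempotentElem (a⁻¹ * a) := by
  show a⁻¹ * a * (a⁻¹ * a) = a⁻¹ * a
  rw [← mul_assoc, inv_mul_inv]

theorem idem_mul {e f : S} (he : IsIdempotentElem e) (hf : IsIdempotentElem f) :
    IsIdempotentElem (e * f) := by
  have h1 : f * (e * f)⁻¹ * e = (e * f)⁻¹ := by
    apply inv_unique
    · calc e * f * (f * (e * f)⁻¹ * e) * (e * f)
          = e * (f * f) * (e * f)⁻¹ * ((e * e) * f) := by simp only [mul_assoc]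
        _ = e * f := by rw [he.eq, hf.eq, mul_inv_mul]
    · calc f * (e * f)⁻¹ * e * (e * f) * (f * (e * f)⁻¹ * e)
          = f * ((e * f)⁻¹ * ((e * e) * (f * f)) * (e * f)⁻¹) * e := by simp only [mul_assoc]
        _ = f * (e * f)⁻¹ * e := by rw [he.eq, hf.eq, inv_mul_inv]
  have h2 : IsIdempotentElem (e * f)⁻¹ := by
    show (e * f)⁻¹ * (e * f)⁻¹ = (e * f)⁻¹
    calc (e * f)⁻¹ * (e * f)⁻¹
        = (f * (e * f)⁻¹ * e) * (f * (e * f)⁻¹ * e) := by rw [h1]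
      _ = f * ((e * f)⁻¹ * (e * f) * (e * f)⁻¹) * e := by simp only [mul_assoc]
      _ = (e * f)⁻¹ := by rw [inv_mul_inv, h1]
  have h3 := inv_of_idem h2
  rw [inv_inv'] at h3
  rw [h3]
  exact h2

theorem idem_comm {e f : S} (he : IsIdempotentElem e) (hf : IsIdempotentElem f) :
    e * f = f * e := by
  have h1 : f * e = (e * f)⁻¹ := by
    apply inv_unique
    · calc e * f * (f * e) * (e * f) = e * (f * f) * (e * e) * f := by simp only [mul_assoc]
        _ = (e * f) * (e * f) := by rw [he.eq, hf.eq]; simp only [mul_assoc]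
        _ = e * f := idem_mul he hf
    · calc f * e * (e * f) * (f * e) = f * (e * e) * (f * f) * e := by simp only [mul_assoc]
        _ = (f * e) * (f * e) := by rw [he.eq, hf.eq]; simp only [mul_assoc]
        _ = f * e := idem_mul hf he
  rw [h1, inv_of_idem (idem_mul he hf)]

theorem eq_mul_dom {a b e : S} (he : IsIdempotentElem e) (h : a = b * e) :
    a = b * (a⁻¹ * a) := by
  have h1 : a * e = a := by rw [h, mul_assoc, he.eq]
  calc a = a * a⁻¹ * a := (mul_inv_mul a).symm
    _ = b * (e * (a⁻¹ * a)) := by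
        conv_lhs => rw [mul_assoc]
        nth_rewrite 1 [h]
        rw [mul_assoc]
    _ = b * (a⁻¹ * a) := by
        rw [idem_comm he (idem_inv_mul a), mul_assoc a⁻¹, h1]

/-- The natural partial order: `a ≤ b` if `a = b * e` for some idempotent `e`. -/
instance : PartialOrder S where
  le a b := ∃ e : S, IsIdempotentElem e ∧ a = b * e
  le_refl a := ⟨a⁻¹ * a, idem_inv_mul a, by rw [← mul_assoc, mul_inv_mul]⟩
  le_trans := by
    rintro a b c ⟨e, he, rfl⟩ ⟨f, hf, rfl⟩
    exact ⟨f * e, idem_mul hf he, mul_assoc _ _ _⟩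
  le_antisymm := by
    rintro a b ⟨e, he, h⟩ ⟨f, hf, h'⟩
    have h1 := eq_mul_dom he h
    have h2 : b * (a⁻¹ * a) = b := by
      calc b * (a⁻¹ * a) = a * (f * (a⁻¹ * a)) := by nth_rewrite 1 [h']; rw [mul_assoc]
        _ = a * a⁻¹ * a * f := by
            rw [idem_comm hf (idem_inv_mul a)]; simp only [mul_assoc]
        _ = b := by rw [mul_inv_mul, ← h']
    exact h1.trans h2

theorem le_def {a b : S} : a ≤ b ↔ ∃ e : S, IsIdempotentElem e ∧ a = b * e := Iff.rfl

/-- Compatible elements: `a⁻¹ * b` and `a * b⁻¹` are both idempotents. -/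
def Compatible (a b : S) : Prop :=
  IsIdempotentElem (a⁻¹ * b) ∧ IsIdempotentElem (a * b⁻¹)

theorem compatible_of_le {a b s : S} (ha : a ≤ s) (hb : b ≤ s) : Compatible a b := by
  obtain ⟨e, he, rfl⟩ := ha
  obtain ⟨f, hf, rfl⟩ := hb
  have key : ∀ g : S, IsIdempotentElem g → g * s⁻¹ = (s * g)⁻¹ := by
    intro g hg
    have hc := idem_comm hg (idem_inv_mul s)
    apply inv_unique
    · calc s * g * (g * s⁻¹) * (s * g) = s * ((g * g) * (s⁻¹ * s)) * g := by
            simp only [mul_assoc]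
        _ = (s * s⁻¹ * s) * (g * g) := by rw [hg.eq, hc]; simp only [mul_assoc, hg.eq]
        _ = s * g := by rw [mul_inv_mul, hg.eq]
    · calc g * s⁻¹ * (s * g) * (g * s⁻¹) = g * ((s⁻¹ * s) * (g * g)) * s⁻¹ := by
            simp only [mul_assoc]
        _ = g * (s⁻¹ * s * s⁻¹) := by rw [hg.eq, ← hc]; simp only [← mul_assoc, hg.eq]
        _ = g * s⁻¹ := by rw [inv_mul_inv]
  constructor
  · rw [← key e he]
    have : e * s⁻¹ * (s * f) = e * (s⁻¹ * s) * f := by simp only [mul_assoc]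
    rw [this]
    exact idem_mul (idem_mul he (idem_inv_mul s)) hf
  · rw [← key f hf]
    have hg := idem_mul he hf
    have : s * e * (f * s⁻¹) = s * (e * f) * s⁻¹ := by simp only [mul_assoc]
    rw [this]
    show s * (e * f) * s⁻¹ * (s * (e * f) * s⁻¹) = _
    calc s * (e * f) * s⁻¹ * (s * (e * f) * s⁻¹)
        = s * ((e * f) * (s⁻¹ * s)) * (e * f) * s⁻¹ := by simp only [mul_assoc]
      _ = (s * s⁻¹ * s) * ((e * f) * (e * f)) * s⁻¹ := by
          rw [idem_comm hg (idem_inv_mul s)]; simp only [mul_assoc]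
      _ = s * (e * f) * s⁻¹ := by rw [mul_inv_mul, hg.eq]

end InverseSemigroup

open InverseSemigroup

/-! ## Boolean inverse semigroups -/

/-- A Boolean inverse semigroup: an inverse semigroup with zero that has all binary compatible
joins, whose multiplication distributes over them (so that the idempotents form a distributive
lattice with bottom `0` and meet `e * f`), and whose lattice of idempotents is a generalized
Boolean algebra. -/
class BooleanInverseSemigroup (S : Type u) extends InverseSemigroup S, SemigroupWithZero S where
  exists_join : ∀ a b : S, Compatible a b → ∃ c, IsLUB {a, b} c
  mul_join : ∀ s a b c : S, Compatible a b → IsLUB {a, b} c → IsLUB {s * a, s * b} (s * c)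
  join_mul : ∀ s a b c : S, Compatible a b → IsLUB {a, b} c → IsLUB {a * s, b * s} (c * s)
  exists_sdiff : ∀ e f : S, IsIdempotentElem e → IsIdempotentElem f →
    ∃ g, IsIdempotentElem g ∧ f * g = 0 ∧ IsLUB {e * f, g} e

/-- Callitic morphisms: homomorphisms of semigroups with zero that preserve binary compatible
joins and are proper and weakly-meet-preserving. -/
@[ext]
structure CalliticHom (S T : Type u) [BooleanInverseSemigroup S] [BooleanInverseSemigroup T] where
  toFun : S → T
  map_mul : ∀ a b, toFun (a * b) = toFun a * toFun b
  map_zero : toFun 0 = 0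
  map_join : ∀ a b c, Compatible a b → IsLUB {a, b} c → IsLUB {toFun a, toFun b} (toFun c)
  proper : ∀ t : T, ∃ F : Set T, F.Finite ∧ IsLUB F t ∧ ∀ x ∈ F, ∃ s : S, x ≤ toFun s
  weakly_meet : ∀ (a b : S) (t : T), t ≤ toFun a → t ≤ toFun b →
    ∃ c : S, c ≤ a ∧ c ≤ b ∧ t ≤ toFun c

namespace CalliticHom

theorem monotone {S T : Type u} [BooleanInverseSemigroup S] [BooleanInverseSemigroup T]
    (θ : CalliticHom S T) {a b : S} (h : a ≤ b) : θ.toFun a ≤ θ.toFun b := by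
  obtain ⟨e, he, rfl⟩ := h
  exact ⟨θ.toFun e, by rw [IsIdempotentElem, ← θ.map_mul, he.eq], θ.map_mul _ _⟩

theorem zero_le' {S : Type u} [BooleanInverseSemigroup S] (a : S) : (0 : S) ≤ a :=
  ⟨0, mul_zero 0, (mul_zero a).symm⟩

/-- A map that preserves zero and binary compatible joins preserves finite joins. -/
theorem map_finite_join {S T : Type u} [BooleanInverseSemigroup S] [BooleanInverseSemigroup T]
    (f : S → T) (h0 : f 0 = 0)
    (hf : ∀ a b c, Compatible a b → IsLUB {a, b} c → IsLUB {f a, f b} (f c))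
    (F : Set S) (hF : F.Finite) (s : S) (hs : IsLUB F s) : IsLUB (f '' F) (f s) := by
  have key : ∀ s ∈ upperBounds F, ∃ c, IsLUB F c ∧ IsLUB (f '' F) (f c) := by
    clear hs s
    induction F, hF using Set.Finite.induction_on with
    | empty =>
      intro s _
      refine ⟨0, ⟨by simp [upperBounds], fun x _ => zero_le' x⟩, ?_⟩
      rw [h0]
      exact ⟨by simp [upperBounds], fun x _ => zero_le' x⟩
    | @insert a F _ _ ih =>
      intro s hs
      obtain ⟨c, hc, hfc⟩ := ih s (fun x hx => hs (Set.mem_insert_of_mem _ hx))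
      have hcs : c ≤ s := hc.2 (fun x hx => hs (Set.mem_insert_of_mem _ hx))
      have hco : Compatible a c := compatible_of_le (hs (Set.mem_insert _ _)) hcs
      obtain ⟨j, hj⟩ := BooleanInverseSemigroup.exists_join a c hco
      have glue : ∀ {R : Type u} [PartialOrder R] {A : Set R} {x y z : R},
          IsLUB A y → IsLUB {x, y} z → IsLUB (insert x A) z := by
        intro R _ A x y z hy hz
        constructor
        · rintro w (rfl | hw)
          · exact hz.1 (by simp)
          · exact (hy.1 hw).trans (hz.1 (by simp))
        · intro w hw
          apply hz.2
          rintro v (rfl | rfl)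
          · exact hw (Set.mem_insert _ _)
          · exact hy.2 (fun q hq => hw (Set.mem_insert_of_mem _ hq))
      refine ⟨j, glue hc hj, ?_⟩
      rw [Set.image_insert_eq]
      exact glue hfc (hf a c j hco hj)
  obtain ⟨c, hc, hfc⟩ := key s hs.1
  rwa [hs.unique hc]

/-- The identity morphism. -/
def id (S : Type u) [BooleanInverseSemigroup S] : CalliticHom S S where
  toFun a := a
  map_mul _ _ := rfl
  map_zero := rfl
  map_join _ _ _ _ h := h
  proper t := ⟨{t}, Set.finite_singleton t, isLUB_singleton, fun x _ => ⟨x, le_rfl⟩⟩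
  weakly_meet _ _ t ha hb := ⟨t, ha, hb, le_rfl⟩

/-- Composition of callitic morphisms. -/
def comp {S T R : Type u} [BooleanInverseSemigroup S] [BooleanInverseSemigroup T]
    [BooleanInverseSemigroup R] (ψ : CalliticHom T R) (θ : CalliticHom S T) :
    CalliticHom S R where
  toFun a := ψ.toFun (θ.toFun a)
  map_mul a b := by rw [θ.map_mul, ψ.map_mul]
  map_zero := by rw [θ.map_zero, ψ.map_zero]
  map_join a b c h hc :=
    ψ.map_join _ _ _
      (compatible_of_le (θ.monotone (hc.1 (by simp))) (θ.monotone (hc.1 (by simp))))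
      (θ.map_join a b c h hc)
  proper t := by
    obtain ⟨F, hF, hFt, hFs⟩ := ψ.proper t
    choose! s hs using hFs
    choose G hG hGs hGr using fun x => θ.proper (s x)
    have hlub : ∀ x ∈ F, IsLUB ((fun y => ψ.toFun y * (x⁻¹ * x)) '' G x) x := by
      intro x hx
      have h := map_finite_join (fun y => ψ.toFun y * (x⁻¹ * x))
        (by simp only [ψ.map_zero, zero_mul])
        (fun a b c hab hc => BooleanInverseSemigroup.join_mul _ _ _ _
          (compatible_of_le (ψ.monotone (hc.1 (by simp))) (ψ.monotone (hc.1 (by simp))))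
          (ψ.map_join a b c hab hc))
        (G x) (hG x) (s x) (hGs x)
      obtain ⟨e, he, hxe⟩ := hs x hx
      have h2 : ψ.toFun (s x) * (x⁻¹ * x) = x := (eq_mul_dom he hxe).symm
      simp only [h2] at h
      exact h
    refine ⟨⋃ x ∈ F, (fun y => ψ.toFun y * (x⁻¹ * x)) '' G x,
      hF.biUnion (fun x _ => (hG x).image _), ⟨?_, ?_⟩, ?_⟩
    · intro y hy
      obtain ⟨x, hx, hy⟩ := Set.mem_iUnion₂.1 hy
      exact ((hlub x hx).1 hy).trans (hFt.1 hx)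
    · intro w hw
      apply hFt.2
      intro x hx
      apply (hlub x hx).2
      intro y hy
      exact hw (Set.mem_iUnion₂.2 ⟨x, hx, hy⟩)
    · intro y hy
      obtain ⟨x, hx, z, hz, rfl⟩ := Set.mem_iUnion₂.1 hy
      obtain ⟨r, hr⟩ := hGr x z hz
      exact ⟨r, le_trans ⟨x⁻¹ * x, idem_inv_mul x, rfl⟩ (ψ.monotone hr)⟩
  weakly_meet a b t ha hb := by
    obtain ⟨c, hca, hcb, htc⟩ := ψ.weakly_meet _ _ t ha hb
    obtain ⟨d, hda, hdb, hcd⟩ := θ.weakly_meet a b c hca hcb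
    exact ⟨d, hda, hdb, htc.trans (ψ.monotone hcd)⟩

end CalliticHom

/-- The objects of the category of Boolean inverse semigroups and callitic morphisms. -/
structure BoolInvSemigrp : Type (u + 1) where
  carrier : Type u
  [str : BooleanInverseSemigroup carrier]

attribute [instance] BoolInvSemigrp.str

instance : Category.{u} BoolInvSemigrp.{u} where
  Hom S T := CalliticHom S.carrier T.carrier
  id S := CalliticHom.id S.carrier
  comp θ ψ := CalliticHom.comp ψ θ

/-! ## Boolean groupoids -/

/-- A (small) groupoid as a set of arrows with a partial multiplication; the product of `g` and
`h` is defined exactly when `dom g = rng h`, and `dom g = g⁻¹ g`, `rng g = g g⁻¹` are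
identities. -/
class ArrowGroupoid (G : Type u) where
  dom : G → G
  rng : G → G
  inv : G → G
  comp : (g h : G) → dom g = rng h → G
  dom_dom : ∀ g, dom (dom g) = dom g
  rng_dom : ∀ g, rng (dom g) = dom g
  dom_rng : ∀ g, dom (rng g) = rng g
  rng_rng : ∀ g, rng (rng g) = rng g
  dom_comp : ∀ g h H, dom (comp g h H) = dom h
  rng_comp : ∀ g h H, rng (comp g h H) = rng g
  comp_assoc : ∀ g h k (H : dom g = rng h) (K : dom h = rng k),
    comp (comp g h H) k ((dom_comp g h H).trans K) =
      comp g (comp h k K) (H.trans (rng_comp h k K).symm)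
  comp_dom : ∀ g, comp g (dom g) (rng_dom g).symm = g
  rng_comp_self : ∀ g, comp (rng g) g (dom_rng g) = g
  dom_inv : ∀ g, dom (inv g) = rng g
  rng_inv : ∀ g, rng (inv g) = dom g
  inv_comp : ∀ g, comp (inv g) g (dom_inv g) = dom g
  comp_inv : ∀ g, comp g (inv g) (rng_inv g).symm = rng g

open ArrowGroupoid

/-- The set `G_o` of identities. -/
def identities (G : Type u) [ArrowGroupoid G] : Set G := {e | dom e = e}

/-- The star of `e`: all arrows with domain `e`. -/
def star {G : Type u} [ArrowGroupoid G] (e : G) : Set G := {g | dom g = e}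

/-- Subset multiplication: all defined products. -/
def setMul {G : Type u} [ArrowGroupoid G] (A B : Set G) : Set G :=
  {x | ∃ a ∈ A, ∃ b ∈ B, ∃ h : dom a = rng b, x = comp a b h}

/-- A local bisection: `A⁻¹ A` and `A A⁻¹` consist of identities. -/
def IsLocalBisection {G : Type u} [ArrowGroupoid G] (A : Set G) : Prop :=
  setMul (inv '' A) A ⊆ identities G ∧ setMul A (inv '' A) ⊆ identities G

/-- A Boolean groupoid: a topological groupoid (continuous multiplication and inversion) that is
étale (`dom : G → G` is a local homeomorphism) and whose space of identities is a locally compact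
Boolean space (Hausdorff, locally compact, zero-dimensional). The topology of `G` itself need not
be Hausdorff. -/
class IsBooleanGroupoid (G : Type u) [ArrowGroupoid G] [TopologicalSpace G] : Prop where
  continuous_comp : Continuous fun p : {p : G × G // dom p.1 = rng p.2} => comp p.1.1 p.1.2 p.2
  continuous_inv : Continuous (inv : G → G)
  etale : IsLocalHomeomorph (dom : G → G)
  t2_identities : T2Space (identities G)
  locallyCompact_identities : LocallyCompactSpace (identities G)
  zeroDim_identities : TopologicalSpace.IsTopologicalBasis {s : Set (identities G) | IsClopen s}

/-- Coherent, continuous covering functors. -/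
@[ext]
structure CoveringHom (G H : Type u) [ArrowGroupoid G] [TopologicalSpace G]
    [ArrowGroupoid H] [TopologicalSpace H] where
  toFun : G → H
  map_dom : ∀ g, toFun (dom g) = dom (toFun g)
  map_rng : ∀ g, toFun (rng g) = rng (toFun g)
  map_comp : ∀ g h (K : dom g = rng h), toFun (comp g h K) =
    comp (toFun g) (toFun h) (by rw [← map_dom, ← map_rng, K])
  star_bijective : ∀ e ∈ identities G, Set.BijOn toFun (star e) (star (toFun e))
  continuous : Continuous toFun
  coherent : ∀ U : Set H, IsCompact U → IsOpen U →
    IsCompact (toFun ⁻¹' U) ∧ IsOpen (toFun ⁻¹' U)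

namespace CoveringHom

/-- The identity functor. -/
def id (G : Type u) [ArrowGroupoid G] [TopologicalSpace G] : CoveringHom G G where
  toFun g := g
  map_dom _ := rfl
  map_rng _ := rfl
  map_comp _ _ _ := rfl
  star_bijective e _ := Set.bijOn_id (star e)
  continuous := continuous_id
  coherent _ hc ho := ⟨hc, ho⟩

/-- Composition of coherent, continuous covering functors. -/
def comp {G H K : Type u} [ArrowGroupoid G] [TopologicalSpace G] [ArrowGroupoid H]
    [TopologicalSpace H] [ArrowGroupoid K] [TopologicalSpace K]
    (ψ : CoveringHom H K) (φ : CoveringHom G H) : CoveringHom G K where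
  toFun g := ψ.toFun (φ.toFun g)
  map_dom g := by rw [φ.map_dom, ψ.map_dom]
  map_rng g := by rw [φ.map_rng, ψ.map_rng]
  map_comp g h K := by simp only [φ.map_comp, ψ.map_comp]
  star_bijective e he :=
    Set.BijOn.comp
      (ψ.star_bijective (φ.toFun e) (by
        show dom (φ.toFun e) = φ.toFun e
        rw [← φ.map_dom, show dom e = e from he]))
      (φ.star_bijective e he)
  continuous := ψ.continuous.comp φ.continuous
  coherent U hc ho :=
    φ.coherent _ (ψ.coherent U hc ho).1 (ψ.coherent U hc ho).2

end CoveringHom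

/-- The objects of the category of Boolean groupoids and coherent, continuous covering
functors. -/
structure BoolGrpd : Type (u + 1) where
  carrier : Type u
  [grpd : ArrowGroupoid carrier]
  [top : TopologicalSpace carrier]
  [boolean : IsBooleanGroupoid carrier]

attribute [instance] BoolGrpd.grpd BoolGrpd.top BoolGrpd.boolean

instance : Category.{u} BoolGrpd.{u} where
  Hom G H := CoveringHom G.carrier H.carrier
  id G := CoveringHom.id G.carrier
  comp φ ψ := CoveringHom.comp ψ φ

/-! ## Prime filters and the Stone groupoid -/

/-- A prime filter of a Boolean inverse semigroup: a non-empty, downwardly directed, upwardly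
closed set without zero that contains `a` or `b` whenever it contains the join of `a` and `b`. -/
structure IsPrimeFilter {S : Type u} [BooleanInverseSemigroup S] (A : Set S) : Prop where
  nonempty : A.Nonempty
  directed : ∀ a ∈ A, ∀ b ∈ A, ∃ c ∈ A, c ≤ a ∧ c ≤ b
  upward : ∀ a ∈ A, ∀ b, a ≤ b → b ∈ A
  zero_notMem : (0 : S) ∉ A
  prime : ∀ a b c, Compatible a b → IsLUB {a, b} c → c ∈ A → a ∈ A ∨ b ∈ A

/-- The upward closure of the product set `A B`. -/
def filterMul {S : Type u} [BooleanInverseSemigroup S] (A B : Set S) : Set S :=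
  {x | ∃ a ∈ A, ∃ b ∈ B, a * b ≤ x}

/-- The set of inverses of the elements of `A`. -/
def filterInv {S : Type u} [BooleanInverseSemigroup S] (A : Set S) : Set S :=
  {x | ∃ a ∈ A, x = a⁻¹}

/-- `p` identifies `G` with the Stone groupoid of `S`: the set of prime filters of `S`, where
`d(A) = (A⁻¹A)↑`, `r(A) = (AA⁻¹)↑`, `A · B = (AB)↑`, with inverse `A⁻¹`, and with the topology that
has the sets of all prime filters containing `a`, for `a` in `S`, as a base. -/
structure IsStoneGroupoid (S G : Type u) [BooleanInverseSemigroup S] [ArrowGroupoid G]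
    [TopologicalSpace G] (p : G ≃ {A : Set S // IsPrimeFilter A}) : Prop where
  dom_eq : ∀ g, (p (dom g)).1 = filterMul (filterInv (p g).1) (p g).1
  rng_eq : ∀ g, (p (rng g)).1 = filterMul (p g).1 (filterInv (p g).1)
  inv_eq : ∀ g, (p (inv g)).1 = filterInv (p g).1
  comp_eq : ∀ g h (H : dom g = rng h), (p (comp g h H)).1 = filterMul (p g).1 (p h).1
  isBasis : TopologicalSpace.IsTopologicalBasis
    {U : Set G | ∃ a : S, U = {g | a ∈ (p g).1}}

/-- A contravariant functor which is, up to natural identification, the one that sends `S` to its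
Stone groupoid and a callitic morphism `θ : S ⟶ T` to the map `A ↦ θ⁻¹(A)`. -/
def IsStoneFunctor (F : BoolInvSemigrp.{u}ᵒᵖ ⥤ BoolGrpd.{u}) : Prop :=
  ∃ p : ∀ S : BoolInvSemigrp.{u},
      (F.obj (Opposite.op S)).carrier ≃ {A : Set S.carrier // IsPrimeFilter A},
    (∀ S, IsStoneGroupoid S.carrier (F.obj (Opposite.op S)).carrier (p S)) ∧
    ∀ (S T : BoolInvSemigrp.{u}) (θ : S ⟶ T) (g : (F.obj (Opposite.op T)).carrier),
      (p S (CoveringHom.toFun (F.map θ.op) g)).1 = CalliticHom.toFun θ ⁻¹' (p T g).1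

/-! ## Compact-open local bisections -/

/-- The set `KB(G)` of compact-open local bisections. -/
def CompactOpenBisections (G : Type u) [ArrowGroupoid G] [TopologicalSpace G] : Set (Set G) :=
  {U | IsCompact U ∧ IsOpen U ∧ IsLocalBisection U}

/-- A contravariant functor which is, up to natural identification, the one that sends `G` to the
semigroup of its compact-open local bisections under subset multiplication and a coherent,
continuous covering functor `φ : G ⟶ H` to the map `U ↦ φ⁻¹(U)`. -/
def IsBisectionFunctor (K : BoolGrpd.{u} ⥤ BoolInvSemigrp.{u}ᵒᵖ) : Prop :=
  ∃ q : ∀ G : BoolGrpd.{u}, (K.obj G).unop.carrier ≃ CompactOpenBisections G.carrier,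
    (∀ G a b, (q G (a * b)).1 = setMul (q G a).1 (q G b).1) ∧
    ∀ (G H : BoolGrpd.{u}) (φ : G ⟶ H) (a : (K.obj H).unop.carrier),
      (q G (CalliticHom.toFun (K.map φ).unop a)).1 = CoveringHom.toFun φ ⁻¹' (q H a).1

end NCStone

namespace NCStone

open InverseSemigroup

/-! ## Arithmetic in inverse semigroups -/

namespace InverseSemigroup

variable {S : Type u} [InverseSemigroup S]

/-! Elements of a Boolean inverse semigroup behave like compact-open bisections of a groupoid, and a
prime filter is an arrow seen as the family of all bisections through it. The two functors are
mutually inverse because an element is recovered from the prime filters containing it, and an arrow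
from the compact-open bisections containing it.

Algebraically, a filter is closed under `a * b⁻¹ * c`, so it behaves like a coset: it is determined
by its domain and any one member (`IsPrimeFilter.eq_preimage`). Domains and products thereby become
preimages under translations, and distributivity makes these prime (`IsPrimeFilter.preimage_mul`).
Relative complements of idempotents make prime filters maximal (`IsPrimeFilter.eq_of_subset`), so an
equality of prime filters needs only the easy inclusion.

Existence of points comes from Zorn's lemma: `exists_primeFilter_of_notMem` separates an element
from a join-closed order ideal. For a principal ideal this shows that `StoneGroupoid.basic` reflects
the order; for the ideal of elements whose basic set is finitely covered it gives compactness. A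
compact-open bisection of the Stone groupoid is then a finite union of basic sets, compatible
because they lie in one bisection, hence is itself basic. This gives the isomorphism of `S` with the
bisections of its Stone groupoid.

In the other direction, compact-open bisections form a base of a Boolean groupoid. If a prime filter
of bisections contained no point filter, compactness would write one of its members as a finite join
of non-members. Hence `pointFilter` is bijective, and the base makes it a homeomorphism.

On morphisms, properness makes the preimage of a prime filter non-empty and weak meet preservation
makes it directed; dually, lifting along stars makes the preimage under a covering functor
multiplicative. -/

theorem idem_mul_inv (a : S) : IsIdempotentElem (a * a⁻¹) := by
  have h := idem_inv_mul a⁻¹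
  rwa [inv_inv'] at h

theorem mul_inv_rev' (a b : S) : (a * b)⁻¹ = b⁻¹ * a⁻¹ := by
  have hc := idem_comm (idem_mul_inv b) (idem_inv_mul a)
  symm
  apply inv_unique
  · calc a * b * (b⁻¹ * a⁻¹) * (a * b) = a * ((b * b⁻¹) * (a⁻¹ * a)) * b := by
          simp only [mul_assoc]
      _ = (a * a⁻¹ * a) * (b * b⁻¹ * b) := by rw [hc]; simp only [mul_assoc]
      _ = a * b := by rw [mul_inv_mul, mul_inv_mul]
  · calc b⁻¹ * a⁻¹ * (a * b) * (b⁻¹ * a⁻¹) = b⁻¹ * ((a⁻¹ * a) * (b * b⁻¹)) * a⁻¹ := by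
          simp only [mul_assoc]
      _ = (b⁻¹ * b * b⁻¹) * (a⁻¹ * a * a⁻¹) := by rw [← hc]; simp only [mul_assoc]
      _ = b⁻¹ * a⁻¹ := by rw [inv_mul_inv, inv_mul_inv]

theorem idem_conj {e : S} (he : IsIdempotentElem e) (a : S) :
    IsIdempotentElem (a * e * a⁻¹) := by
  have h := idem_mul_inv (a * e)
  rw [mul_inv_rev', inv_of_idem he] at h
  have : a * e * (e * a⁻¹) = a * (e * e) * a⁻¹ := by simp only [mul_assoc]
  rwa [this, he.eq] at h

theorem mul_idem_eq {e : S} (he : IsIdempotentElem e) (a : S) : a * e = a * e * a⁻¹ * a := by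
  calc a * e = a * a⁻¹ * a * e := by rw [mul_inv_mul]
    _ = a * ((a⁻¹ * a) * e) := by simp only [mul_assoc]
    _ = a * e * a⁻¹ * a := by
      rw [idem_comm (idem_inv_mul a) he]; simp only [mul_assoc]

theorem idem_mul_eq {e : S} (he : IsIdempotentElem e) (a : S) : e * a = a * (a⁻¹ * e * a) := by
  calc e * a = e * (a * a⁻¹) * a := by rw [mul_assoc, mul_inv_mul]
    _ = a * (a⁻¹ * e * a) := by
      rw [idem_comm he (idem_mul_inv a)]; simp only [mul_assoc]

theorem mul_idem_le (a : S) {e : S} (he : IsIdempotentElem e) : a * e ≤ a := ⟨e, he, rfl⟩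

theorem idem_mul_le (a : S) {e : S} (he : IsIdempotentElem e) : e * a ≤ a := by
  refine ⟨a⁻¹ * e * a, ?_, idem_mul_eq he a⟩
  have h := idem_conj he a⁻¹
  rwa [inv_inv'] at h

theorem le_iff_eq_idem_mul {a b : S} : a ≤ b ↔ ∃ e : S, IsIdempotentElem e ∧ a = e * b := by
  constructor
  · rintro ⟨e, he, rfl⟩
    exact ⟨_, idem_conj he b, mul_idem_eq he b⟩
  · rintro ⟨e, he, rfl⟩
    exact idem_mul_le b he

theorem eq_mul_of_le {a b : S} (h : a ≤ b) : a = b * (a⁻¹ * a) := by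
  obtain ⟨e, he, h⟩ := h
  exact eq_mul_dom he h

theorem mul_le_mul_left'' {a b : S} (h : a ≤ b) (c : S) : c * a ≤ c * b := by
  obtain ⟨e, he, rfl⟩ := h
  exact ⟨e, he, (mul_assoc _ _ _).symm⟩

theorem mul_le_mul_right'' {a b : S} (h : a ≤ b) (c : S) : a * c ≤ b * c := by
  obtain ⟨e, he, rfl⟩ := le_iff_eq_idem_mul.1 h
  exact le_iff_eq_idem_mul.2 ⟨e, he, mul_assoc _ _ _⟩

theorem mul_le_mul'' {a b c d : S} (h : a ≤ b) (k : c ≤ d) : a * c ≤ b * d :=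
  (mul_le_mul_left'' k a).trans (mul_le_mul_right'' h d)

theorem inv_le_inv'' {a b : S} (h : a ≤ b) : a⁻¹ ≤ b⁻¹ := by
  obtain ⟨e, he, rfl⟩ := h
  rw [mul_inv_rev', inv_of_idem he]
  exact idem_mul_le _ he

theorem idem_of_le {a e : S} (he : IsIdempotentElem e) (h : a ≤ e) : IsIdempotentElem a := by
  obtain ⟨f, hf, rfl⟩ := h
  exact idem_mul he hf

/-- Right multiplication by `b⁻¹ * b` and by `c⁻¹ * c` restrict `c` and `b` below a common upper
bound to the same element. -/
theorem mul_dom_comm {b c d : S} (hb : b ≤ d) (hc : c ≤ d) : b * (c⁻¹ * c) = c * (b⁻¹ * b) := by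
  calc b * (c⁻¹ * c) = d * ((b⁻¹ * b) * (c⁻¹ * c)) := by
        conv_lhs => rw [eq_mul_of_le hb]
        rw [mul_assoc]
    _ = d * (c⁻¹ * c) * (b⁻¹ * b) := by
        rw [idem_comm (idem_inv_mul b) (idem_inv_mul c), ← mul_assoc d]
    _ = c * (b⁻¹ * b) := by rw [← eq_mul_of_le hc]

theorem Compatible.inv {a b : S} (h : Compatible a b) : Compatible a⁻¹ b⁻¹ := by
  refine ⟨?_, ?_⟩
  · rw [inv_inv']; exact h.2
  · rw [inv_inv']; exact h.1

theorem isLUB_inv {a b c : S} (h : IsLUB {a, b} c) : IsLUB {a⁻¹, b⁻¹} c⁻¹ := by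
  constructor
  · rintro x (rfl | rfl)
    · exact inv_le_inv'' (h.1 (by simp))
    · exact inv_le_inv'' (h.1 (by simp))
  · intro x hx
    have : c ≤ x⁻¹ := h.2 (by
      rintro y (rfl | rfl)
      · have := inv_le_inv'' (hx (show y⁻¹ ∈ _ by simp)); rwa [inv_inv'] at this
      · have := inv_le_inv'' (hx (show y⁻¹ ∈ _ by simp)); rwa [inv_inv'] at this)
    have := inv_le_inv'' this
    rwa [inv_inv'] at this

end InverseSemigroup

/-! ## Filters -/

section Filters

variable {S : Type u} [BooleanInverseSemigroup S]

theorem zero_le'' (a : S) : (0 : S) ≤ a := CalliticHom.zero_le' a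

theorem eq_zero_of_le {a : S} (h : a ≤ 0) : a = 0 := le_antisymm h (zero_le'' a)

theorem compatible_of_isLUB {a b c : S} (h : IsLUB {a, b} c) : Compatible a b :=
  compatible_of_le (h.1 (by simp)) (h.1 (by simp))

/-- A filter: a non-empty, downwardly directed, upwardly closed set. -/
structure IsFilter (A : Set S) : Prop where
  nonempty : A.Nonempty
  directed : ∀ a ∈ A, ∀ b ∈ A, ∃ c ∈ A, c ≤ a ∧ c ≤ b
  upward : ∀ a ∈ A, ∀ b, a ≤ b → b ∈ A

theorem IsPrimeFilter.isFilter {A : Set S} (h : IsPrimeFilter A) : IsFilter A :=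
  ⟨h.nonempty, h.directed, h.upward⟩

theorem mem_filterInv {A : Set S} {x : S} : x ∈ filterInv A ↔ x⁻¹ ∈ A := by
  constructor
  · rintro ⟨a, ha, rfl⟩
    rwa [inv_inv']
  · intro h
    exact ⟨_, h, (inv_inv' x).symm⟩

theorem filterInv_filterInv (A : Set S) : filterInv (filterInv A) = A := by
  ext x
  rw [mem_filterInv, mem_filterInv, inv_inv']

theorem IsPrimeFilter.filterInv {A : Set S} (h : IsPrimeFilter A) :
    IsPrimeFilter (filterInv A) where
  nonempty := by
    obtain ⟨a, ha⟩ := h.nonempty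
    exact ⟨a⁻¹, a, ha, rfl⟩
  directed := by
    rintro _ ⟨a, ha, rfl⟩ _ ⟨b, hb, rfl⟩
    obtain ⟨c, hc, hca, hcb⟩ := h.directed a ha b hb
    exact ⟨c⁻¹, ⟨c, hc, rfl⟩, inv_le_inv'' hca, inv_le_inv'' hcb⟩
  upward := by
    rintro _ ⟨a, ha, rfl⟩ b hb
    rw [mem_filterInv]
    refine h.upward a ha _ ?_
    have := inv_le_inv'' hb
    rwa [inv_inv'] at this
  zero_notMem := by
    rw [mem_filterInv, inv_of_idem (mul_zero (0 : S))]
    exact h.zero_notMem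
  prime a b c hab hc hcA := by
    rw [mem_filterInv] at *
    rw [mem_filterInv]
    exact h.prime _ _ _ hab.inv (isLUB_inv hc) hcA

/-! ### Membership criteria for domains, ranges and products of filters -/

namespace IsFilter

variable {A B : Set S}

/-- A common lower bound `e` of the three members satisfies `e = e * e⁻¹ * e`, which lies below the
product. This coset-like property underlies all the membership criteria that follow. -/
theorem ternary (hA : IsFilter A) {a b c : S} (ha : a ∈ A) (hb : b ∈ A) (hc : c ∈ A) :
    a * b⁻¹ * c ∈ A := by
  obtain ⟨d, hd, hda, hdb⟩ := hA.directed a ha b hb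
  obtain ⟨e, he, hed, hec⟩ := hA.directed d hd c hc
  refine hA.upward e he _ ?_
  calc e = e * e⁻¹ * e := (mul_inv_mul e).symm
    _ ≤ a * b⁻¹ * c :=
      mul_le_mul'' (mul_le_mul'' (hed.trans hda) (inv_le_inv'' (hed.trans hdb))) hec

/-- One arbitrary member suffices to test the domain, so the domain is a preimage of `A` under a
translation. -/
theorem mem_dom_iff (hA : IsFilter A) {a : S} (ha : a ∈ A) {x : S} :
    x ∈ filterMul (filterInv A) A ↔ a * x ∈ A := by
  constructor
  · rintro ⟨_, ⟨b, hb, rfl⟩, c, hc, h⟩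
    refine hA.upward _ (hA.ternary ha hb hc) _ ?_
    rw [mul_assoc]
    exact mul_le_mul_left'' h a
  · intro h
    refine ⟨a⁻¹, ⟨a, ha, rfl⟩, a * x, h, ?_⟩
    rw [← mul_assoc]
    exact idem_mul_le x (idem_inv_mul a)

theorem mem_rng_iff (hA : IsFilter A) {a : S} (ha : a ∈ A) {x : S} :
    x ∈ filterMul A (filterInv A) ↔ x * a ∈ A := by
  constructor
  · rintro ⟨b, hb, _, ⟨c, hc, rfl⟩, h⟩
    exact hA.upward _ (hA.ternary hb hc ha) _ (mul_le_mul_right'' h a)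
  · intro h
    refine ⟨x * a, h, a⁻¹, ⟨a, ha, rfl⟩, ?_⟩
    rw [mul_assoc]
    exact mul_idem_le x (idem_mul_inv a)

/-- Replacing the left factor `c` by the fixed `a` costs `a⁻¹ * c`, an element of the common domain
and range, which acts on `B` by left multiplication. -/
theorem mem_mul_iff (_hA : IsFilter A) (hB : IsFilter B)
    (h : filterMul (filterInv A) A = filterMul B (filterInv B)) {a : S} (ha : a ∈ A) {x : S} :
    x ∈ filterMul A B ↔ a⁻¹ * x ∈ B := by
  constructor
  · rintro ⟨c, hc, b, hb, hx⟩
    have h1 : a⁻¹ * c ∈ filterMul (filterInv A) A := ⟨a⁻¹, ⟨a, ha, rfl⟩, c, hc, le_rfl⟩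
    rw [h, hB.mem_rng_iff hb] at h1
    refine hB.upward _ h1 _ ?_
    rw [mul_assoc]
    exact mul_le_mul_left'' hx _
  · intro hx
    refine ⟨a, ha, _, hx, ?_⟩
    rw [← mul_assoc]
    exact idem_mul_le x (idem_mul_inv a)

theorem mul_idem_mem_iff (hA : IsFilter A) {e x : S} (he : IsIdempotentElem e) (heA : e ∈ A) :
    e * x ∈ A ↔ x ∈ A := by
  refine ⟨fun h => hA.upward _ h _ (idem_mul_le x he), fun h => ?_⟩
  have := hA.ternary heA heA h
  rwa [inv_of_idem he, he.eq] at this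

theorem mem_idem_mul_iff (hA : IsFilter A) {e x : S} (he : IsIdempotentElem e) (heA : e ∈ A) :
    x * e ∈ A ↔ x ∈ A := by
  refine ⟨fun h => hA.upward _ h _ (mul_idem_le x he), fun h => ?_⟩
  have := hA.ternary h heA heA
  rwa [inv_of_idem he, mul_assoc, he.eq] at this

theorem dom_eq_self (hA : IsFilter A) {e : S} (he : IsIdempotentElem e) (heA : e ∈ A) :
    filterMul (filterInv A) A = A := by
  ext x
  rw [hA.mem_dom_iff heA, hA.mul_idem_mem_iff he heA]

theorem rng_eq_self (hA : IsFilter A) {e : S} (he : IsIdempotentElem e) (heA : e ∈ A) :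
    filterMul A (filterInv A) = A := by
  ext x
  rw [hA.mem_rng_iff heA, hA.mem_idem_mul_iff he heA]

theorem inv_mul_mem_dom {a : S} (ha : a ∈ A) : a⁻¹ * a ∈ filterMul (filterInv A) A :=
  ⟨a⁻¹, ⟨a, ha, rfl⟩, a, ha, le_rfl⟩

theorem mul_inv_mem_rng {a : S} (ha : a ∈ A) : a * a⁻¹ ∈ filterMul A (filterInv A) :=
  ⟨a, ha, a⁻¹, ⟨a, ha, rfl⟩, le_rfl⟩

/-- A filter that coincides with its domain contains an idempotent below each of its members. -/
theorem exists_idem_le (hA : IsFilter A) (h : filterMul (filterInv A) A = A) {x : S}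
    (hx : x ∈ A) : ∃ e ∈ A, IsIdempotentElem e ∧ e ≤ x := by
  rw [← h] at hx
  obtain ⟨_, ⟨b, hb, rfl⟩, c, hc, hle⟩ := hx
  obtain ⟨d, hd, hdb, hdc⟩ := hA.directed b hb c hc
  refine ⟨d⁻¹ * d, ?_, idem_inv_mul d, (mul_le_mul'' (inv_le_inv'' hdb) hdc).trans hle⟩
  rw [← h]
  exact inv_mul_mem_dom hd

end IsFilter

/-- The inverse image of a prime filter under left multiplication. -/
theorem IsPrimeFilter.preimage_mul {A : Set S} (hA : IsPrimeFilter A) (s : S) (hs : s⁻¹ * s ∈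
    filterMul A (NCStone.filterInv A)) :
    IsPrimeFilter {x | s⁻¹ * x ∈ A} where
  nonempty := by
    obtain ⟨a, ha⟩ := hA.nonempty
    refine ⟨s * a, ?_⟩
    have := (hA.isFilter.mem_rng_iff ha).1 hs
    rwa [mul_assoc] at this
  directed := by
    intro a ha b hb
    obtain ⟨c, hc, hca, hcb⟩ := hA.directed _ ha _ hb
    -- A lower bound `c` in `A` is carried back by `s`; the hypothesis on `s⁻¹ * s` then puts `s⁻¹ *
    -- (s * c)` in `A`.
    have h1 : ∀ x, c ≤ s⁻¹ * x → s * c ≤ x := by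
      intro x hx
      refine (mul_le_mul_left'' hx s).trans ?_
      rw [← mul_assoc]
      exact idem_mul_le x (idem_mul_inv s)
    refine ⟨s * c, ?_, h1 a hca, h1 b hcb⟩
    have := (hA.isFilter.mem_rng_iff hc).1 hs
    rwa [mul_assoc] at this
  upward a ha b hab := hA.upward _ ha _ (mul_le_mul_left'' hab _)
  zero_notMem := by
    show s⁻¹ * 0 ∉ A
    rw [mul_zero]
    exact hA.zero_notMem
  prime a b c hab hc hcA := by
    have h := BooleanInverseSemigroup.mul_join s⁻¹ a b c hab hc
    exact hA.prime _ _ _ (compatible_of_isLUB h) h hcA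

/-! ### Groupoid operations on prime filters -/

namespace IsPrimeFilter

variable {A B : Set S}

theorem dom (hA : IsPrimeFilter A) : IsPrimeFilter (filterMul (NCStone.filterInv A) A) := by
  obtain ⟨a, ha⟩ := hA.nonempty
  have : filterMul (NCStone.filterInv A) A = {x | a⁻¹⁻¹ * x ∈ A} := by
    ext x
    rw [hA.isFilter.mem_dom_iff ha, inv_inv']
    rfl
  rw [this]
  apply hA.preimage_mul
  rw [inv_inv']
  exact IsFilter.mul_inv_mem_rng ha

theorem rng (hA : IsPrimeFilter A) : IsPrimeFilter (filterMul A (NCStone.filterInv A)) := by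
  have := hA.filterInv.dom
  rwa [filterInv_filterInv] at this

theorem mul (hA : IsPrimeFilter A) (hB : IsPrimeFilter B)
    (h : filterMul (NCStone.filterInv A) A = filterMul B (NCStone.filterInv B)) :
    IsPrimeFilter (filterMul A B) := by
  obtain ⟨a, ha⟩ := hA.nonempty
  have : filterMul A B = {x | a⁻¹ * x ∈ B} := by
    ext x
    exact hA.isFilter.mem_mul_iff hB.isFilter h ha
  rw [this]
  apply hB.preimage_mul
  rw [← h]
  exact IsFilter.inv_mul_mem_dom ha

theorem dom_dom (hA : IsPrimeFilter A) :
    filterMul (NCStone.filterInv (filterMul (NCStone.filterInv A) A))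
      (filterMul (NCStone.filterInv A) A) = filterMul (NCStone.filterInv A) A := by
  obtain ⟨a, ha⟩ := hA.nonempty
  exact hA.dom.isFilter.dom_eq_self (idem_inv_mul a) (IsFilter.inv_mul_mem_dom ha)

theorem rng_dom (hA : IsPrimeFilter A) :
    filterMul (filterMul (NCStone.filterInv A) A)
      (NCStone.filterInv (filterMul (NCStone.filterInv A) A)) =
      filterMul (NCStone.filterInv A) A := by
  obtain ⟨a, ha⟩ := hA.nonempty
  exact hA.dom.isFilter.rng_eq_self (idem_inv_mul a) (IsFilter.inv_mul_mem_dom ha)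

/-- Testing with members `a` and `b` reduces the left side to `a⁻¹ * a * (b * x) ∈ B`; since `a⁻¹ *
a` lies in the range of `B`, it can be dropped. -/
theorem dom_mul (hA : IsPrimeFilter A) (hB : IsPrimeFilter B)
    (h : filterMul (NCStone.filterInv A) A = filterMul B (NCStone.filterInv B)) :
    filterMul (NCStone.filterInv (filterMul A B)) (filterMul A B) =
      filterMul (NCStone.filterInv B) B := by
  obtain ⟨a, ha⟩ := hA.nonempty
  obtain ⟨b, hb⟩ := hB.nonempty
  have hab : a * b ∈ filterMul A B := ⟨a, ha, b, hb, le_rfl⟩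
  ext x
  rw [(hA.mul hB h).isFilter.mem_dom_iff hab, hA.isFilter.mem_mul_iff hB.isFilter h ha,
    hB.isFilter.mem_dom_iff hb]
  have h1 := IsFilter.inv_mul_mem_dom ha
  rw [h] at h1
  have h2 : a⁻¹ * (a * b * x) = a⁻¹ * a * (b * x) := by simp only [mul_assoc]
  rw [h2]
  refine ⟨fun h3 => hB.upward _ h3 _ (idem_mul_le _ (idem_inv_mul a)), fun h3 => ?_⟩
  exact (hB.isFilter.mem_rng_iff h3).1 h1

end IsPrimeFilter

theorem filterInv_filterMul (A B : Set S) :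
    filterInv (filterMul A B) = filterMul (filterInv B) (filterInv A) := by
  ext x
  rw [mem_filterInv]
  constructor
  · rintro ⟨a, ha, b, hb, h⟩
    refine ⟨b⁻¹, ⟨b, hb, rfl⟩, a⁻¹, ⟨a, ha, rfl⟩, ?_⟩
    rw [← mul_inv_rev', ← inv_inv' x]
    exact inv_le_inv'' h
  · rintro ⟨_, ⟨b, hb, rfl⟩, _, ⟨a, ha, rfl⟩, h⟩
    refine ⟨a, ha, b, hb, ?_⟩
    rw [← inv_inv' (a * b), mul_inv_rev']
    exact inv_le_inv'' h

theorem filterMul_assoc (A B C : Set S) :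
    filterMul (filterMul A B) C = filterMul A (filterMul B C) := by
  ext x
  constructor
  · rintro ⟨y, ⟨a, ha, b, hb, hy⟩, c, hc, h⟩
    refine ⟨a, ha, b * c, ⟨b, hb, c, hc, le_rfl⟩, ?_⟩
    rw [← mul_assoc]
    exact (mul_le_mul_right'' hy c).trans h
  · rintro ⟨a, ha, y, ⟨b, hb, c, hc, hy⟩, h⟩
    refine ⟨a * b, ⟨a, ha, b, hb, le_rfl⟩, c, hc, ?_⟩
    rw [mul_assoc]
    exact (mul_le_mul_left'' hy a).trans h

namespace IsPrimeFilter

variable {A B : Set S}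

theorem rng_mul (hA : IsPrimeFilter A) (hB : IsPrimeFilter B)
    (h : filterMul (NCStone.filterInv A) A = filterMul B (NCStone.filterInv B)) :
    filterMul (filterMul A B) (NCStone.filterInv (filterMul A B)) =
      filterMul A (NCStone.filterInv A) := by
  have := hB.filterInv.dom_mul hA.filterInv
    (by rw [filterInv_filterInv, filterInv_filterInv, h])
  rwa [← filterInv_filterMul, filterInv_filterInv, filterInv_filterInv] at this

theorem mul_dom (hA : IsPrimeFilter A) : filterMul A (filterMul (NCStone.filterInv A) A) = A := by
  obtain ⟨a, ha⟩ := hA.nonempty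
  ext x
  rw [hA.isFilter.mem_mul_iff hA.dom.isFilter hA.rng_dom.symm ha, hA.isFilter.mem_dom_iff ha,
    ← mul_assoc]
  exact ⟨fun h => hA.upward _ h _ (idem_mul_le x (idem_mul_inv a)),
    fun h => hA.isFilter.ternary ha ha h⟩

theorem rng_mul_self (hA : IsPrimeFilter A) :
    filterMul (filterMul A (NCStone.filterInv A)) A = A := by
  rw [filterMul_assoc, hA.mul_dom]

/-- A prime filter is determined by its domain and any of its members. -/
theorem eq_preimage (hA : IsPrimeFilter A) {a : S} (ha : a ∈ A) :
    A = {x | a⁻¹ * x ∈ filterMul (NCStone.filterInv A) A} := by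
  conv_lhs => rw [← hA.mul_dom]
  ext x
  exact hA.isFilter.mem_mul_iff hA.dom.isFilter hA.rng_dom.symm ha

/-- This is what makes the domain map injective on the set of prime filters containing a given
element. -/
theorem eq_of_dom_eq (hA : IsPrimeFilter A) (hB : IsPrimeFilter B) {a : S} (ha : a ∈ A)
    (hb : a ∈ B) (h : filterMul (NCStone.filterInv A) A = filterMul (NCStone.filterInv B) B) :
    A = B := by
  rw [hA.eq_preimage ha, hB.eq_preimage hb, h]

/-- The prime filter with domain `A` that contains `s`, for an identity `A` containing
`s⁻¹ * s`. -/
theorem exists_dom_eq (hA : IsPrimeFilter A) {s : S} (hs : s⁻¹ * s ∈ A) :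
    ∃ B, IsPrimeFilter B ∧ s ∈ B ∧ filterMul (NCStone.filterInv B) B = A := by
  have h := hA.isFilter.rng_eq_self (idem_inv_mul s) hs
  have hB := hA.preimage_mul s (by rwa [h])
  refine ⟨_, hB, hs, ?_⟩
  ext x
  rw [hB.isFilter.mem_dom_iff hs]
  show s⁻¹ * (s * x) ∈ A ↔ _
  rw [← mul_assoc, hA.isFilter.mul_idem_mem_iff (idem_inv_mul s) hs]

/-- Split `f` as the join of `f * e` and a relative complement. Primeness selects one of them, and
the first would force `e` into `A`. The Boolean axiom on idempotents enters the theory of prime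
filters here. -/
theorem exists_disjoint_idem (hA : IsPrimeFilter A) {e f : S} (he : IsIdempotentElem e)
    (heA : e ∉ A) (hf : IsIdempotentElem f) (hfA : f ∈ A) :
    ∃ g ∈ A, IsIdempotentElem g ∧ e * g = 0 := by
  obtain ⟨g, hg, h0, hlub⟩ := BooleanInverseSemigroup.exists_sdiff f e hf he
  rcases hA.prime _ _ _ (compatible_of_isLUB hlub) hlub hfA with h | h
  · exact absurd (hA.upward _ h _ (idem_mul_le e hf)) heA
  · exact ⟨g, h, hg, h0⟩

theorem not_mem_of_mul_eq_zero (hA : IsPrimeFilter A) {e f : S} (he : IsIdempotentElem e)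
    (heA : e ∈ A) (h : e * f = 0) : f ∉ A := by
  intro hf
  have := (hA.isFilter.mul_idem_mem_iff he heA).2 hf
  rw [h] at this
  exact hA.zero_notMem this

/-- Prime filters are maximal. -/
theorem eq_of_subset (hA : IsPrimeFilter A) (hB : IsPrimeFilter B) (h : A ⊆ B) : A = B := by
  obtain ⟨a, ha⟩ := hA.nonempty
  refine hA.eq_of_dom_eq hB ha (h ha) ?_
  have hsub : filterMul (NCStone.filterInv A) A ⊆ filterMul (NCStone.filterInv B) B := by
    intro x hx
    rw [hB.isFilter.mem_dom_iff (h ha)]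
    exact h ((hA.isFilter.mem_dom_iff ha).1 hx)
  -- An idempotent of the domain of `B` missing from that of `A` would have a disjoint `g` in the
  -- domain of `A`, hence in that of `B`, where two members cannot multiply to zero.
  refine Set.Subset.antisymm hsub fun x hx => ?_
  obtain ⟨e, he, hei, hex⟩ := hB.dom.isFilter.exists_idem_le hB.dom_dom hx
  refine hA.dom.upward e ?_ x hex
  by_contra hne
  obtain ⟨g, hg, -, h0⟩ := hA.dom.exists_disjoint_idem hei hne (idem_inv_mul a)
    (IsFilter.inv_mul_mem_dom ha)
  exact hB.dom.not_mem_of_mul_eq_zero hei he h0 (hsub hg)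

theorem exists_mem_of_isLUB (hA : IsPrimeFilter A) {F : Set S} (hF : F.Finite) :
    ∀ s ∈ A, IsLUB F s → ∃ x ∈ F, x ∈ A := by
  -- The induction runs over bounded sets: a common upper bound makes each new element compatible
  -- with the join built so far, so that the partial joins exist.
  suffices H : ∀ s ∈ upperBounds F, ∃ c ≤ s, IsLUB F c ∧ (c ∈ A → ∃ x ∈ F, x ∈ A) by
    intro s hs hsF
    obtain ⟨c, -, hc, h⟩ := H s hsF.1
    rw [hsF.unique hc] at hs
    exact h hs
  induction F, hF using Set.Finite.induction_on with
  | empty =>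
    intro s _
    exact ⟨0, zero_le'' s, ⟨by simp [upperBounds], fun x _ => zero_le'' x⟩,
      fun h => absurd h hA.zero_notMem⟩
  | @insert a F _ _ ih =>
    intro s hs
    obtain ⟨c, hcs, hc, h⟩ := ih s (fun x hx => hs (Set.mem_insert_of_mem _ hx))
    have hco : Compatible a c := compatible_of_le (hs (Set.mem_insert _ _)) hcs
    obtain ⟨j, hj⟩ := BooleanInverseSemigroup.exists_join a c hco
    refine ⟨j, hj.2 ?_, ⟨?_, ?_⟩, ?_⟩
    · rintro x (rfl | rfl)
      · exact hs (Set.mem_insert _ _)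
      · exact hcs
    · rintro x (rfl | hx)
      · exact hj.1 (by simp)
      · exact (hc.1 hx).trans (hj.1 (by simp))
    · intro w hw
      apply hj.2
      rintro v (rfl | rfl)
      · exact hw (Set.mem_insert _ _)
      · exact hc.2 (fun q hq => hw (Set.mem_insert_of_mem _ hq))
    · intro hjA
      rcases hA.prime _ _ _ hco hj hjA with h1 | h1
      · exact ⟨a, Set.mem_insert _ _, h1⟩
      · obtain ⟨x, hx, hxA⟩ := h h1
        exact ⟨x, Set.mem_insert_of_mem _ hx, hxA⟩

end IsPrimeFilter

/-- The filter generated by a filter and a domain idempotent. -/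
theorem IsFilter.adjoin {A : Set S} (hA : IsFilter A) {e : S} :
    IsFilter {x | ∃ f ∈ A, f * e ≤ x} where
  nonempty := by
    obtain ⟨a, ha⟩ := hA.nonempty
    exact ⟨a * e, a, ha, le_rfl⟩
  directed := by
    rintro x ⟨f, hf, hx⟩ y ⟨g, hg, hy⟩
    obtain ⟨c, hc, hcf, hcg⟩ := hA.directed f hf g hg
    exact ⟨c * e, ⟨c, hc, le_rfl⟩, (mul_le_mul_right'' hcf e).trans hx,
      (mul_le_mul_right'' hcg e).trans hy⟩
  upward := by
    rintro x ⟨f, hf, hx⟩ y hy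
    exact ⟨f, hf, hx.trans hy⟩

/-- An element outside an additive order ideal belongs to a prime filter disjoint from it. -/
theorem exists_primeFilter_of_notMem {I : Set S} (h0 : 0 ∈ I)
    (hdown : ∀ a ∈ I, ∀ b ≤ a, b ∈ I)
    (hjoin : ∀ a ∈ I, ∀ b ∈ I, ∀ c, IsLUB {a, b} c → c ∈ I) {a : S} (ha : a ∉ I) :
    ∃ A, IsPrimeFilter A ∧ a ∈ A ∧ Disjoint A I := by
  obtain ⟨A, haA, hmax⟩ := zorn_subset_nonempty {F : Set S | IsFilter F ∧ Disjoint F I}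
    (by
      intro c hc hchain hne
      refine ⟨⋃₀ c, ⟨⟨?_, ?_, ?_⟩, ?_⟩, fun s hs => Set.subset_sUnion_of_mem hs⟩
      · obtain ⟨F, hF⟩ := hne
        obtain ⟨x, hx⟩ := (hc hF).1.nonempty
        exact ⟨x, F, hF, hx⟩
      · rintro x ⟨F, hF, hx⟩ y ⟨G, hG, hy⟩
        rcases hchain.total hF hG with h | h
        · obtain ⟨z, hz, h1⟩ := (hc hG).1.directed x (h hx) y hy
          exact ⟨z, ⟨G, hG, hz⟩, h1⟩
        · obtain ⟨z, hz, h1⟩ := (hc hF).1.directed x hx y (h hy)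
          exact ⟨z, ⟨F, hF, hz⟩, h1⟩
      · rintro x ⟨F, hF, hx⟩ y hy
        exact ⟨F, hF, (hc hF).1.upward x hx y hy⟩
      · rw [Set.disjoint_sUnion_left]
        exact fun F hF => (hc hF).2)
    (Set.Ici a)
    ⟨⟨⟨a, le_refl a⟩, fun x hx y hy => ⟨a, le_refl a, hx, hy⟩, fun x hx y hy => le_trans hx hy⟩,
      Set.disjoint_left.2 fun x hx hxI => ha (hdown x hxI a hx)⟩
  obtain ⟨hA, hAI⟩ := hmax.prop
  refine ⟨A, ⟨hA.nonempty, hA.directed, hA.upward,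
    fun h => Set.disjoint_left.1 hAI h h0, ?_⟩, haA (le_refl a), hAI⟩
  intro b c d _ hd hdA
  by_contra! hbc
  -- If the filter generated by `A` and `x⁻¹ * x` missed `I`, maximality would make it equal to `A`;
  -- but it contains `d * (x⁻¹ * x) = x`.
  have key : ∀ x ≤ d, x ∉ A → ∃ f ∈ A, f * (x⁻¹ * x) ∈ I := by
    intro x hx hxA
    by_contra! hf
    have hsub : A ⊆ {y | ∃ f ∈ A, f * (x⁻¹ * x) ≤ y} := fun y hy =>
      ⟨y, hy, mul_idem_le y (idem_inv_mul x)⟩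
    have := hmax.eq_of_subset ⟨hA.adjoin (e := x⁻¹ * x), Set.disjoint_left.2
      fun y ⟨f, hfA, hfy⟩ hyI => hf f hfA (hdown _ hyI _ hfy)⟩ hsub
    apply hxA
    rw [this]
    exact ⟨d, hdA, (eq_mul_of_le hx).ge⟩
  obtain ⟨f, hf, hfI⟩ := key b (hd.1 (by simp)) hbc.1
  obtain ⟨g, hg, hgI⟩ := key c (hd.1 (by simp)) hbc.2
  obtain ⟨k, hk, hkf, hkg⟩ := hA.directed f hf g hg
  obtain ⟨m, hm, hmk, hmd⟩ := hA.directed k hk d hdA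
  -- Restricting the join `d` to the domain of `m ≤ d` exhibits `m` as the join of `m * (b⁻¹ * b)`
  -- and `m * (c⁻¹ * c)`. Both lie in `I`, so `m` would lie in both `A` and `I`.
  have hlub := BooleanInverseSemigroup.join_mul (m⁻¹ * m) b c d (compatible_of_isLUB hd) hd
  rw [← eq_mul_of_le hmd, mul_dom_comm (hd.1 (by simp)) hmd, mul_dom_comm (hd.1 (by simp)) hmd]
    at hlub
  refine Set.disjoint_left.1 hAI hm (hjoin _ ?_ _ ?_ m hlub)
  · exact hdown _ hfI _ (mul_le_mul_right'' (hmk.trans hkf) _)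
  · exact hdown _ hgI _ (mul_le_mul_right'' (hmk.trans hkg) _)

/-- The natural partial order is detected by prime filters. -/
theorem le_of_forall_primeFilter {a b : S} (h : ∀ A, IsPrimeFilter A → a ∈ A → b ∈ A) :
    a ≤ b := by
  by_contra hab
  -- The ideal to avoid is the principal one below `b`.
  obtain ⟨A, hA, haA, hdis⟩ := exists_primeFilter_of_notMem (I := Set.Iic b) (zero_le'' b)
    (fun x hx y hy => le_trans hy hx)
    (fun x hx y hy c hc => hc.2 (by rintro z (rfl | rfl) <;> assumption)) hab
  exact Set.disjoint_left.1 hdis (h A hA haA) (le_refl b)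

end Filters

open ArrowGroupoid

/-! ## The Stone groupoid -/

/-- The set of prime filters. -/
def StoneGroupoid (S : Type u) [BooleanInverseSemigroup S] : Type u :=
  {A : Set S // IsPrimeFilter A}

namespace StoneGroupoid

variable {S : Type u} [BooleanInverseSemigroup S]

@[ext]
theorem ext {A B : StoneGroupoid S} (h : A.1 = B.1) : A = B := Subtype.ext h

instance : ArrowGroupoid (StoneGroupoid S) where
  dom A := ⟨_, A.2.dom⟩
  rng A := ⟨_, A.2.rng⟩
  inv A := ⟨_, A.2.filterInv⟩
  comp A B h := ⟨_, A.2.mul B.2 (congrArg Subtype.val h)⟩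
  dom_dom A := ext A.2.dom_dom
  rng_dom A := ext A.2.rng_dom
  dom_rng A := ext (by
    have := A.2.filterInv.dom_dom
    rwa [filterInv_filterInv] at this)
  rng_rng A := ext (by
    have := A.2.filterInv.rng_dom
    rwa [filterInv_filterInv] at this)
  dom_comp A B h := ext (A.2.dom_mul B.2 (congrArg Subtype.val h))
  rng_comp A B h := ext (A.2.rng_mul B.2 (congrArg Subtype.val h))
  comp_assoc A B C _ _ := ext (filterMul_assoc A.1 B.1 C.1)
  comp_dom A := ext A.2.mul_dom
  rng_comp_self A := ext A.2.rng_mul_self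
  dom_inv A := ext (by
    show filterMul (filterInv (filterInv A.1)) _ = _
    rw [filterInv_filterInv])
  rng_inv A := ext (by
    show filterMul _ (filterInv (filterInv A.1)) = _
    rw [filterInv_filterInv])
  inv_comp _ := rfl
  comp_inv _ := rfl

/-- The set of prime filters that contain `a`. -/
def basic (a : S) : Set (StoneGroupoid S) := {A | a ∈ A.1}

theorem mem_basic {a : S} {A : StoneGroupoid S} : A ∈ basic a ↔ a ∈ A.1 := Iff.rfl

instance : TopologicalSpace (StoneGroupoid S) :=
  TopologicalSpace.generateFrom (Set.range basic)

theorem isTopologicalBasis_basic :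
    TopologicalSpace.IsTopologicalBasis (Set.range (basic (S := S))) where
  exists_subset_inter := by
    rintro _ ⟨a, rfl⟩ _ ⟨b, rfl⟩ A ⟨ha, hb⟩
    obtain ⟨c, hc, hca, hcb⟩ := A.2.directed a ha b hb
    exact ⟨basic c, ⟨c, rfl⟩, hc, fun B hB => ⟨B.2.upward c hB a hca, B.2.upward c hB b hcb⟩⟩
  sUnion_eq := Set.eq_univ_of_forall fun A => by
    obtain ⟨a, ha⟩ := A.2.nonempty
    exact ⟨basic a, ⟨a, rfl⟩, ha⟩
  eq_generateFrom := rfl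

theorem isOpen_basic (a : S) : IsOpen (basic a) :=
  isTopologicalBasis_basic.isOpen ⟨a, rfl⟩

theorem basic_subset_iff {a b : S} : basic a ⊆ basic b ↔ a ≤ b :=
  ⟨fun h => le_of_forall_primeFilter fun A hA ha => @h ⟨A, hA⟩ ha,
    fun h A hA => A.2.upward a hA b h⟩

theorem basic_injective : Function.Injective (basic (S := S)) := fun _ _ h =>
  le_antisymm (basic_subset_iff.1 h.subset) (basic_subset_iff.1 h.symm.subset)

theorem basic_zero : basic (0 : S) = ∅ :=
  Set.eq_empty_of_forall_notMem fun A hA => A.2.zero_notMem hA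

theorem basic_of_isLUB {a b c : S} (h : IsLUB {a, b} c) : basic c = basic a ∪ basic b := by
  ext A
  refine ⟨fun hA => A.2.prime _ _ _ (compatible_of_isLUB h) h hA, ?_⟩
  rintro (hA | hA)
  · exact basic_subset_iff.2 (h.1 (by simp)) hA
  · exact basic_subset_iff.2 (h.1 (by simp)) hA

/-- The elements below `a` whose basic sets are finitely covered form a join-closed order ideal. If
`a` were outside it, some prime filter through `a` would avoid it; but that filter lies in one `U
i`, hence has a member below `a` covered by a single set. -/
theorem isCompact_basic (a : S) : IsCompact (basic a) := by
  apply isCompact_of_finite_subcover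
  intro ι U hU hcov
  by_contra hfin
  obtain ⟨A, hA, haA, hdis⟩ := exists_primeFilter_of_notMem
    (I := {x : S | x ≤ a ∧ ∃ t : Finset ι, basic x ⊆ ⋃ i ∈ t, U i})
    ⟨zero_le'' a, ∅, by simp [basic_zero]⟩
    (fun x ⟨hxa, t, ht⟩ y hyx => ⟨hyx.trans hxa, t, (basic_subset_iff.2 hyx).trans ht⟩)
    (by
      classical
      rintro x ⟨hxa, t, ht⟩ y ⟨hya, r, hr⟩ z hz
      refine ⟨hz.2 (by rintro w (rfl | rfl) <;> assumption), t ∪ r, ?_⟩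
      rw [basic_of_isLUB hz, Finset.set_biUnion_union]
      exact Set.union_subset_union ht hr)
    (a := a) (fun h => hfin h.2)
  obtain ⟨i, hi⟩ := Set.mem_iUnion.1 (hcov (show (⟨A, hA⟩ : StoneGroupoid S) ∈ basic a from haA))
  obtain ⟨_, ⟨x, rfl⟩, hx, hxU⟩ := isTopologicalBasis_basic.exists_subset_of_mem_open hi (hU i)
  obtain ⟨y, hy, hyx, hya⟩ := hA.directed x hx a haA
  refine Set.disjoint_left.1 hdis hy ⟨hya, {i}, ?_⟩
  simpa using (basic_subset_iff.2 hyx).trans hxU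

theorem mem_identities_of_idem {A : StoneGroupoid S} {e : S} (he : IsIdempotentElem e)
    (h : e ∈ A.1) : A ∈ identities (StoneGroupoid S) :=
  ext (A.2.isFilter.dom_eq_self he h)

theorem exists_idem_le_of_mem_identities {A : StoneGroupoid S}
    (hA : A ∈ identities (StoneGroupoid S)) {x : S} (hx : x ∈ A.1) :
    ∃ e ∈ A.1, IsIdempotentElem e ∧ e ≤ x :=
  A.2.isFilter.exists_idem_le (congrArg Subtype.val hA) hx

theorem injOn_dom_basic (a : S) : Set.InjOn dom (basic a) := fun A hA B hB h =>
  ext (A.2.eq_of_dom_eq B.2 hA hB (congrArg Subtype.val h))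

theorem inv_inv_arrow (A : StoneGroupoid S) : inv (inv A) = A := ext (filterInv_filterInv A.1)

theorem injOn_rng_basic (a : S) : Set.InjOn rng (basic a) := fun A hA B hB h => by
  have h1 : dom (inv A) = dom (inv B) := by rw [dom_inv, dom_inv, h]
  have h2 := injOn_dom_basic a⁻¹ (show inv A ∈ basic a⁻¹ from ⟨a, hA, rfl⟩)
    (show inv B ∈ basic a⁻¹ from ⟨a, hB, rfl⟩) h1
  rw [← inv_inv_arrow A, h2, inv_inv_arrow]

/-- Besides making the domain map open, this supplies lifts: an identity containing `a⁻¹ * a` is the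
domain of an arrow through `a`. -/
theorem image_dom_basic (a : S) : dom '' basic a = basic (a⁻¹ * a) := by
  ext A
  constructor
  · rintro ⟨B, hB, rfl⟩
    exact IsFilter.inv_mul_mem_dom hB
  · intro hA
    obtain ⟨B, hB, haB, h⟩ := A.2.exists_dom_eq hA
    exact ⟨⟨B, hB⟩, haB, ext h⟩

/-! ### The Stone groupoid is a Boolean groupoid -/

theorem continuous_inv : Continuous (inv : StoneGroupoid S → StoneGroupoid S) := by
  rw [isTopologicalBasis_basic.continuous_iff]
  rintro _ ⟨a, rfl⟩
  have : inv ⁻¹' basic a = basic a⁻¹ := by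
    ext A
    exact mem_filterInv
  rw [this]
  exact isOpen_basic _

theorem continuous_comp : Continuous
    fun p : {p : StoneGroupoid S × StoneGroupoid S // dom p.1 = rng p.2} =>
      comp p.1.1 p.1.2 p.2 := by
  rw [isTopologicalBasis_basic.continuous_iff]
  rintro _ ⟨x, rfl⟩
  rw [isOpen_iff_forall_mem_open]
  rintro ⟨⟨A, B⟩, h⟩ ⟨a, ha, b, hb, hx⟩
  refine ⟨Subtype.val ⁻¹' (basic a ×ˢ basic b), ?_,
    ((isOpen_basic a).prod (isOpen_basic b)).preimage continuous_subtype_val, ha, hb⟩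
  rintro ⟨⟨A', B'⟩, h'⟩ ⟨ha', hb'⟩
  exact ⟨a, ha', b, hb', hx⟩

theorem continuous_dom : Continuous (dom : StoneGroupoid S → StoneGroupoid S) := by
  rw [isTopologicalBasis_basic.continuous_iff]
  rintro _ ⟨x, rfl⟩
  rw [isOpen_iff_forall_mem_open]
  rintro A ⟨_, ⟨a, ha, rfl⟩, b, hb, hx⟩
  exact ⟨basic a ∩ basic b, fun B hB => ⟨a⁻¹, ⟨a, hB.1, rfl⟩, b, hB.2, hx⟩,
    (isOpen_basic a).inter (isOpen_basic b), ha, hb⟩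

theorem isOpenMap_dom : IsOpenMap (dom : StoneGroupoid S → StoneGroupoid S) := by
  rw [isTopologicalBasis_basic.isOpenMap_iff]
  rintro _ ⟨a, rfl⟩
  rw [image_dom_basic]
  exact isOpen_basic _

theorem isLocalHomeomorph_dom : IsLocalHomeomorph (dom : StoneGroupoid S → StoneGroupoid S) := by
  rw [isLocalHomeomorph_iff_isOpenEmbedding_restrict]
  intro A
  obtain ⟨a, ha⟩ := A.2.nonempty
  refine ⟨basic a, (isOpen_basic a).mem_nhds ha, ?_⟩
  exact .of_continuous_injective_isOpenMap (continuous_dom.comp continuous_subtype_val)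
    (Set.injOn_iff_injective.1 (injOn_dom_basic a))
    (isOpenMap_dom.domRestrict (isOpen_basic a))

/-- An identity avoiding `e` contains an element `g` with `e * g = 0`, and the basic set of `g` is a
neighbourhood missing that of `e`. -/
theorem isClosed_basic_identities {e : S} (he : IsIdempotentElem e) :
    IsClosed (Subtype.val ⁻¹' basic e : Set (identities (StoneGroupoid S))) := by
  rw [← isOpen_compl_iff, isOpen_iff_forall_mem_open]
  rintro ⟨A, hA⟩ heA
  obtain ⟨a, ha⟩ := A.2.nonempty
  obtain ⟨f, hfA, hf, -⟩ := exists_idem_le_of_mem_identities hA ha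
  obtain ⟨g, hgA, -, h0⟩ := A.2.exists_disjoint_idem he heA hf hfA
  exact ⟨Subtype.val ⁻¹' basic g,
    fun B hgB heB => B.1.2.not_mem_of_mul_eq_zero he heB h0 hgB,
    (isOpen_basic g).preimage continuous_subtype_val, hgA⟩

theorem isClopen_basic_identities {e : S} (he : IsIdempotentElem e) :
    IsClopen (Subtype.val ⁻¹' basic e : Set (identities (StoneGroupoid S))) :=
  ⟨isClosed_basic_identities he, (isOpen_basic e).preimage continuous_subtype_val⟩

theorem exists_basic_subset {A : identities (StoneGroupoid S)}
    {U : Set (identities (StoneGroupoid S))} (hU : IsOpen U) (hA : A ∈ U) :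
    ∃ e, IsIdempotentElem e ∧ A.1 ∈ basic e ∧ Subtype.val ⁻¹' basic e ⊆ U := by
  obtain ⟨V, hV, rfl⟩ := isOpen_induced_iff.1 hU
  obtain ⟨_, ⟨x, rfl⟩, hx, hxV⟩ := isTopologicalBasis_basic.exists_subset_of_mem_open hA hV
  obtain ⟨e, heA, he, hex⟩ := exists_idem_le_of_mem_identities A.2 hx
  exact ⟨e, he, heA, fun B hB => hxV (basic_subset_iff.2 hex hB)⟩

instance : T2Space (identities (StoneGroupoid S)) := by
  refine ⟨fun A B hAB => ?_⟩
  have : ¬ A.1.1 ⊆ B.1.1 := fun h => hAB (Subtype.ext (ext (A.1.2.eq_of_subset B.1.2 h)))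
  obtain ⟨x, hxA, hxB⟩ := Set.not_subset.1 this
  obtain ⟨e, heA, he, hex⟩ := exists_idem_le_of_mem_identities A.2 hxA
  have heB : e ∉ B.1.1 := fun h => hxB (B.1.2.upward e h x hex)
  exact ⟨_, _, (isClopen_basic_identities he).isOpen,
    (isClopen_basic_identities he).compl.isOpen, heA, heB, disjoint_compl_right⟩

instance : LocallyCompactSpace (identities (StoneGroupoid S)) := by
  -- Since the space is Hausdorff, one compact neighbourhood of each point is enough.
  have : WeaklyLocallyCompactSpace (identities (StoneGroupoid S)) := by
    refine ⟨fun A => ?_⟩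
    obtain ⟨e, he, heA, -⟩ := exists_basic_subset isOpen_univ (Set.mem_univ A)
    refine ⟨_, ?_, (isClopen_basic_identities he).isOpen.mem_nhds heA⟩
    rw [Topology.IsInducing.subtypeVal.isCompact_preimage_iff]
    · exact isCompact_basic e
    · intro B hB
      exact ⟨⟨B, mem_identities_of_idem he hB⟩, rfl⟩
  infer_instance

instance : IsBooleanGroupoid (StoneGroupoid S) where
  continuous_comp := continuous_comp
  continuous_inv := continuous_inv
  etale := isLocalHomeomorph_dom
  t2_identities := inferInstance
  locallyCompact_identities := inferInstance
  zeroDim_identities :=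
    TopologicalSpace.isTopologicalBasis_of_isOpen_of_nhds (fun _ h => h.isOpen) fun A U hA hU => by
      obtain ⟨e, he, heA, heU⟩ := exists_basic_subset hU hA
      exact ⟨_, isClopen_basic_identities he, heA, heU⟩

/-- An arrow `C` through `a * b` factors as `(C · B⁻¹) · B`, where `B` is the arrow through `b` with
the same domain as `C`. -/
theorem basic_mul (a b : S) : basic (a * b) = setMul (basic a) (basic b) := by
  ext C
  constructor
  · intro hC
    have hdC : b⁻¹ * b ∈ (dom C).1 := by
      refine (dom C).2.upward _ (IsFilter.inv_mul_mem_dom hC) _ ?_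
      rw [mul_inv_rev']
      calc b⁻¹ * a⁻¹ * (a * b) = b⁻¹ * (a⁻¹ * a * b) := by simp only [mul_assoc]
        _ ≤ b⁻¹ * b := mul_le_mul_left'' (idem_mul_le b (idem_inv_mul a)) _
    rw [← mem_basic, ← image_dom_basic] at hdC
    obtain ⟨B, hB, hBC⟩ := hdC
    have h1 : dom C = rng (inv B) := by rw [rng_inv, hBC]
    have h2 : dom (comp C (inv B) h1) = rng B := by rw [dom_comp, dom_inv]
    refine ⟨comp C (inv B) h1, ?_, B, hB, h2, ?_⟩
    · refine ⟨a * b, hC, b⁻¹, ⟨b, hB, rfl⟩, ?_⟩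
      rw [mul_assoc]
      exact mul_idem_le a (idem_mul_inv b)
    · refine ext ?_
      show C.1 = filterMul (filterMul C.1 (filterInv B.1)) B.1
      have h3 : filterMul (filterInv B.1) B.1 = filterMul (filterInv C.1) C.1 :=
        congrArg Subtype.val hBC
      rw [filterMul_assoc, h3, C.2.mul_dom]
  · rintro ⟨A, hA, B, hB, h, rfl⟩
    exact ⟨a, hA, b, hB, le_rfl⟩

/-- Identities equal their own domains, so every prime filter through `a` contains `a⁻¹ * a`; hence
`a` lies below an idempotent. -/
theorem idem_of_basic_subset {a : S} (h : basic a ⊆ identities (StoneGroupoid S)) :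
    IsIdempotentElem a := by
  refine idem_of_le (idem_inv_mul a) (basic_subset_iff.1 fun A hA => ?_)
  rw [← image_dom_basic]
  exact ⟨A, hA, h hA⟩

theorem basic_inv (a : S) : basic a⁻¹ = inv '' basic a := by
  ext A
  constructor
  · intro hA
    exact ⟨inv A, mem_filterInv.2 hA, inv_inv_arrow A⟩
  · rintro ⟨B, hB, rfl⟩
    exact ⟨a, hB, rfl⟩

end StoneGroupoid

/-! ## Arithmetic in groupoids -/

namespace ArrowGroupoid

variable {G : Type u} [ArrowGroupoid G]

theorem comp_congr {a a' b b' : G} (ha : a = a') (hb : b = b') (h : dom a = rng b)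
    (h' : dom a' = rng b') : comp a b h = comp a' b' h' := by
  subst ha hb
  rfl

theorem dom_mem_identities (g : G) : dom g ∈ identities G := dom_dom g

theorem rng_mem_identities (g : G) : rng g ∈ identities G := dom_rng g

theorem rng_of_mem {e : G} (he : e ∈ identities G) : rng e = e := by
  have := rng_dom e
  rwa [show dom e = e from he] at this

theorem comp_identity {e g : G} (he : e ∈ identities G) (h : dom g = rng e) :
    comp g e h = g := by
  rw [rng_of_mem he] at h
  subst h
  exact comp_dom g

theorem identity_comp {e g : G} (he : e ∈ identities G) (h : dom e = rng g) :
    comp e g h = g := by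
  have h' : e = rng g := by rwa [show dom e = e from he] at h
  subst h'
  exact rng_comp_self g

theorem comp_inv_cancel (a b : G) (h : dom a = rng b)
    (h' : dom (comp a b h) = rng (inv b)) : comp (comp a b h) (inv b) h' = a := by
  rw [comp_assoc a b (inv b) h (rng_inv b).symm,
    comp_congr rfl (comp_inv b) _ (by rw [rng_rng, h]), comp_identity (rng_mem_identities b)]

theorem comp_inv_cancel' (a b : G) (h : dom a = rng (inv b))
    (h' : dom (comp a (inv b) h) = rng b) : comp (comp a (inv b) h) b h' = a := by
  rw [comp_assoc a (inv b) b h (dom_inv b),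
    comp_congr rfl (inv_comp b) _ (by rw [rng_dom, h, rng_inv]),
    comp_identity (dom_mem_identities b)]

theorem inv_inv_arrow (g : G) : inv (inv g) = g := by
  have h : dom (inv (inv g)) = rng (inv g) := dom_inv _
  have h1 : dom (comp (inv (inv g)) (inv g) h) = rng g := by rw [dom_comp, dom_inv]
  have h2 := comp_inv_cancel' (inv (inv g)) g (by rw [dom_inv]) h1
  rw [← h2, comp_congr (inv_comp (inv g)) rfl _ (by rw [dom_dom, dom_inv]),
    identity_comp (dom_mem_identities _)]

theorem eq_inv_of_comp_mem {a b : G} (h : dom a = rng b) (hab : comp a b h ∈ identities G) :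
    a = inv b := by
  have h' : dom (comp a b h) = rng (inv b) := by rw [dom_comp, rng_inv]
  rw [← comp_inv_cancel a b h h', identity_comp hab]

theorem inv_injective : Function.Injective (inv : G → G) :=
  Function.LeftInverse.injective inv_inv_arrow

theorem image_inv_eq (A : Set G) : inv '' A = inv ⁻¹' A := by
  rw [Set.image_eq_preimage_of_inverse inv_inv_arrow inv_inv_arrow]

theorem mem_image_inv {A : Set G} {g : G} : g ∈ inv '' A ↔ inv g ∈ A := by
  rw [image_inv_eq]
  rfl

theorem eq_of_comp_inv_mem {a b : G} (h : dom a = dom b)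
    (hab : comp a (inv b) (h.trans (rng_inv b).symm) ∈ identities G) : a = b := by
  rw [eq_inv_of_comp_mem _ hab, inv_inv_arrow]

theorem eq_of_inv_comp_mem {a b : G} (h : rng a = rng b)
    (hab : comp (inv a) b ((dom_inv a).trans h) ∈ identities G) : a = b :=
  inv_injective (eq_inv_of_comp_mem _ hab)

/-! ## Local bisections -/

theorem setMul_subset_identities_right {A B : Set G} :
    setMul A (inv '' B) ⊆ identities G ↔ ∀ a ∈ A, ∀ b ∈ B, dom a = dom b → a = b := by
  constructor
  · intro h a ha b hb hab
    exact eq_of_comp_inv_mem hab (h ⟨a, ha, inv b, ⟨b, hb, rfl⟩, _, rfl⟩)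
  · rintro h _ ⟨a, ha, _, ⟨b, hb, rfl⟩, hab, rfl⟩
    obtain rfl := h a ha b hb (by rw [hab, rng_inv])
    rw [comp_inv]
    exact rng_mem_identities a

theorem setMul_subset_identities_left {A B : Set G} :
    setMul (inv '' A) B ⊆ identities G ↔ ∀ a ∈ A, ∀ b ∈ B, rng a = rng b → a = b := by
  constructor
  · intro h a ha b hb hab
    exact eq_of_inv_comp_mem hab (h ⟨inv a, ⟨a, ha, rfl⟩, b, hb, _, rfl⟩)
  · rintro h _ ⟨_, ⟨a, ha, rfl⟩, b, hb, hab, rfl⟩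
    obtain rfl := h a ha b hb (by rw [← hab, dom_inv])
    rw [inv_comp]
    exact dom_mem_identities a

theorem isLocalBisection_iff {A : Set G} :
    IsLocalBisection A ↔ Set.InjOn rng A ∧ Set.InjOn dom A := by
  rw [IsLocalBisection, setMul_subset_identities_left, setMul_subset_identities_right]
  exact ⟨fun h => ⟨fun a ha b hb => h.1 a ha b hb, fun a ha b hb => h.2 a ha b hb⟩,
    fun h => ⟨fun a ha b hb => @h.1 a ha b hb, fun a ha b hb => @h.2 a ha b hb⟩⟩

theorem isLocalBisection_of_subset {A B : Set G} (h : A ⊆ B) (hB : IsLocalBisection B) :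
    IsLocalBisection A := by
  rw [isLocalBisection_iff] at *
  exact ⟨hB.1.mono h, hB.2.mono h⟩

theorem isLocalBisection_inv {A : Set G} (hA : IsLocalBisection A) :
    IsLocalBisection (inv '' A) := by
  rw [isLocalBisection_iff] at *
  constructor
  · rintro _ ⟨a, ha, rfl⟩ _ ⟨b, hb, rfl⟩ h
    rw [rng_inv, rng_inv] at h
    rw [hA.2 ha hb h]
  · rintro _ ⟨a, ha, rfl⟩ _ ⟨b, hb, rfl⟩ h
    rw [dom_inv, dom_inv] at h
    rw [hA.1 ha hb h]

theorem isLocalBisection_setMul {A B : Set G} (hA : IsLocalBisection A)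
    (hB : IsLocalBisection B) : IsLocalBisection (setMul A B) := by
  rw [isLocalBisection_iff] at *
  constructor
  · rintro _ ⟨a, ha, b, hb, h, rfl⟩ _ ⟨a', ha', b', hb', h', rfl⟩ H
    rw [rng_comp, rng_comp] at H
    obtain rfl := hA.1 ha ha' H
    obtain rfl := hB.1 hb hb' (h.symm.trans h')
    rfl
  · rintro _ ⟨a, ha, b, hb, h, rfl⟩ _ ⟨a', ha', b', hb', h', rfl⟩ H
    rw [dom_comp, dom_comp] at H
    obtain rfl := hB.2 hb hb' H
    obtain rfl := hA.2 ha ha' (h.trans h'.symm)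
    rfl

theorem setMul_assoc (A B C : Set G) : setMul (setMul A B) C = setMul A (setMul B C) := by
  ext x
  constructor
  · rintro ⟨_, ⟨a, ha, b, hb, h, rfl⟩, c, hc, h', rfl⟩
    rw [dom_comp] at h'
    exact ⟨a, ha, _, ⟨b, hb, c, hc, h', rfl⟩, by rw [rng_comp, h], comp_assoc a b c h h'⟩
  · rintro ⟨a, ha, _, ⟨b, hb, c, hc, h, rfl⟩, h', rfl⟩
    rw [rng_comp] at h'
    exact ⟨_, ⟨a, ha, b, hb, h', rfl⟩, c, hc, by rw [dom_comp, h], (comp_assoc a b c h' h).symm⟩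

theorem setMul_mono {A A' B B' : Set G} (h : A ⊆ A') (k : B ⊆ B') :
    setMul A B ⊆ setMul A' B' := by
  rintro _ ⟨a, ha, b, hb, H, rfl⟩
  exact ⟨a, h ha, b, k hb, H, rfl⟩

theorem setMul_union (A B C : Set G) : setMul A (B ∪ C) = setMul A B ∪ setMul A C := by
  apply Set.Subset.antisymm
  · rintro _ ⟨a, ha, b, hb | hb, h, rfl⟩
    · exact .inl ⟨a, ha, b, hb, h, rfl⟩
    · exact .inr ⟨a, ha, b, hb, h, rfl⟩
  · exact Set.union_subset (setMul_mono le_rfl Set.subset_union_left)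
      (setMul_mono le_rfl Set.subset_union_right)

theorem union_setMul (A B C : Set G) : setMul (A ∪ B) C = setMul A C ∪ setMul B C := by
  apply Set.Subset.antisymm
  · rintro _ ⟨a, ha | ha, b, hb, h, rfl⟩
    · exact .inl ⟨a, ha, b, hb, h, rfl⟩
    · exact .inr ⟨a, ha, b, hb, h, rfl⟩
  · exact Set.union_subset (setMul_mono Set.subset_union_left le_rfl)
      (setMul_mono Set.subset_union_right le_rfl)

theorem setMul_identities_subset {A E : Set G} (hE : E ⊆ identities G) : setMul A E ⊆ A := by
  rintro _ ⟨a, ha, e, he, h, rfl⟩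
  rwa [comp_identity (hE he)]

theorem setMul_inv_mul {A : Set G} (hA : IsLocalBisection A) :
    setMul (setMul A (inv '' A)) A = A := by
  apply Set.Subset.antisymm
  · rintro _ ⟨x, hx, a, ha, h, rfl⟩
    rwa [identity_comp (hA.2 hx)]
  · intro a ha
    exact ⟨rng a, ⟨a, ha, inv a, ⟨a, ha, rfl⟩, _, (comp_inv a).symm⟩, a, ha, dom_rng a,
      (rng_comp_self a).symm⟩

theorem image_inv_image_inv (A : Set G) : inv '' (inv '' A) = A := by
  ext x
  rw [mem_image_inv, mem_image_inv, inv_inv_arrow]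

/-- Restricting a local bisection to the domains of a subset gives the subset. -/
theorem setMul_dom_of_subset {A B : Set G} (h : A ⊆ B) (hB : IsLocalBisection B) :
    setMul B (setMul (inv '' A) A) = A := by
  apply Set.Subset.antisymm
  · rintro _ ⟨b, hb, x, hx, hbx, rfl⟩
    have hxi := (isLocalBisection_of_subset h hB).1 hx
    obtain ⟨_, ⟨c, hc, rfl⟩, a, ha, hca, rfl⟩ := hx
    rw [comp_identity hxi]
    have : dom b = dom a := by
      rw [hbx, rng_of_mem hxi, ← dom_comp _ _ hca]
      exact hxi.symm
    rwa [(isLocalBisection_iff.1 hB).2 hb (h ha) this]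
  · intro a ha
    exact ⟨a, h ha, dom a, ⟨inv a, ⟨a, ha, rfl⟩, a, ha, _, (inv_comp a).symm⟩, _,
      (comp_dom a).symm⟩

/-- Write `x ∈ E` as a product of two members of `E`. Injectivity of the domain and range maps
forces both factors to be `x`, and `x = x x` in a groupoid means that `x` is an identity. -/
theorem setMul_self_iff {E : Set G} (hE : IsLocalBisection E) :
    setMul E E = E ↔ E ⊆ identities G := by
  rw [isLocalBisection_iff] at hE
  constructor
  · intro h x hx
    obtain ⟨a, ha, b, hb, hab, hxab⟩ := h.symm ▸ hx
    have h1 : x = b := hE.2 hx hb (by rw [hxab, dom_comp])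
    have h2 : x = a := hE.1 hx ha (by rw [hxab, rng_comp])
    subst h1 h2
    have : rng x = x := (comp_inv x).symm.trans ((comp_congr hxab rfl _ _).trans
      (comp_inv_cancel x x hab (by rw [dom_comp, rng_inv])))
    rw [← this]
    exact rng_mem_identities x
  · intro h
    refine Set.Subset.antisymm (setMul_identities_subset h) fun x hx => ?_
    exact ⟨x, hx, x, hx, (h hx).trans (rng_of_mem (h hx)).symm, (comp_identity (h hx) _).symm⟩

/-- In a regular pair of local bisections each is contained in the inverse of the other. -/
theorem subset_inv_of_regular {A B : Set G} (hB : IsLocalBisection B)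
    (h : setMul (setMul B A) B = B) : B ⊆ inv '' A := by
  rw [isLocalBisection_iff] at hB
  intro b hb
  obtain ⟨_, ⟨b₁, hb₁, a, ha, h₁, rfl⟩, b₂, hb₂, h₂, hx⟩ := h.symm ▸ hb
  have e₂ : b = b₂ := hB.2 hb hb₂ (by rw [hx, dom_comp])
  have e₁ : b = b₁ := hB.1 hb hb₁ (by rw [hx, rng_comp, rng_comp])
  subst e₁ e₂
  refine ⟨a, ha, (eq_inv_of_comp_mem h₁ ?_).symm⟩
  have : comp b a h₁ = rng b := by
    rw [← comp_inv b, ← comp_inv_cancel _ b h₂ (by rw [dom_comp, rng_inv])]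
    exact comp_congr hx.symm rfl _ _
  rw [this]
  exact rng_mem_identities b

end ArrowGroupoid

/-! ## Compact-open sets in Boolean groupoids -/

section Topology

variable {G : Type u} [ArrowGroupoid G] [TopologicalSpace G] [IsBooleanGroupoid G]

open ArrowGroupoid

theorem continuous_dom : Continuous (dom : G → G) := IsBooleanGroupoid.etale.continuous

theorem isOpenMap_dom : IsOpenMap (dom : G → G) := IsBooleanGroupoid.etale.isOpenMap

/-- Inversion as a homeomorphism. -/
def invHomeo (G : Type u) [ArrowGroupoid G] [TopologicalSpace G] [IsBooleanGroupoid G] :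
    G ≃ₜ G where
  toFun := inv
  invFun := inv
  left_inv := inv_inv_arrow
  right_inv := inv_inv_arrow
  continuous_toFun := IsBooleanGroupoid.continuous_inv
  continuous_invFun := IsBooleanGroupoid.continuous_inv

theorem rng_eq_dom_inv {G : Type u} [ArrowGroupoid G] : (rng : G → G) = dom ∘ inv := by
  ext g
  exact (dom_inv g).symm

theorem isLocalHomeomorph_rng : IsLocalHomeomorph (rng : G → G) := by
  rw [rng_eq_dom_inv]
  exact IsBooleanGroupoid.etale.comp (invHomeo G).isLocalHomeomorph

theorem continuous_rng : Continuous (rng : G → G) := isLocalHomeomorph_rng.continuous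

theorem isOpenMap_rng : IsOpenMap (rng : G → G) := isLocalHomeomorph_rng.isOpenMap

theorem isOpen_identities : IsOpen (identities G) := by
  have : identities G = Set.range (dom : G → G) := by
    ext g
    exact ⟨fun h => ⟨g, h⟩, by rintro ⟨g, rfl⟩; exact dom_mem_identities g⟩
  rw [this]
  exact isOpenMap_dom.isOpen_range

theorem isCompact_inv {A : Set G} (hA : IsCompact A) : IsCompact (inv '' A) :=
  hA.image IsBooleanGroupoid.continuous_inv

theorem isOpen_inv {A : Set G} (hA : IsOpen A) : IsOpen (inv '' A) :=
  (invHomeo G).isOpenMap A hA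

/-- The shear `(g, h) ↦ (g h, h⁻¹)` is an involution of the space of composable pairs and turns
multiplication into the first projection, which is open because the range map is. -/
theorem isOpen_setMul {A B : Set G} (hA : IsOpen A) (hB : IsOpen B) : IsOpen (setMul A B) := by
  have hfst : IsOpenMap fun p : {p : G × G // dom p.1 = rng p.2} => p.1.1 := by
    intro W hW
    rw [isOpen_iff_forall_mem_open]
    rintro _ ⟨⟨⟨g, h⟩, H⟩, hgh, rfl⟩
    obtain ⟨W', hW', rfl⟩ := isOpen_induced_iff.1 hW
    obtain ⟨U, V, hU, hV, hgU, hhV, hUV⟩ := isOpen_prod_iff.1 hW' g h hgh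
    -- An arrow in `U` has a composable partner in `V` exactly when its domain lies in the open set
    -- `rng '' V`.
    refine ⟨U ∩ dom ⁻¹' (rng '' V), ?_,
      hU.inter ((isOpenMap_rng V hV).preimage continuous_dom), hgU, ⟨h, hhV, H.symm⟩⟩
    rintro x ⟨hxU, y, hyV, hy⟩
    exact ⟨⟨(x, y), hy.symm⟩, hUV ⟨hxU, hyV⟩, rfl⟩
  let Φ : {p : G × G // dom p.1 = rng p.2} → {p : G × G // dom p.1 = rng p.2} := fun p =>
    ⟨(comp p.1.1 p.1.2 p.2, inv p.1.2), by rw [dom_comp, rng_inv]⟩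
  have hΦ : Continuous Φ := Continuous.subtype_mk (IsBooleanGroupoid.continuous_comp.prodMk
    (IsBooleanGroupoid.continuous_inv.comp (continuous_snd.comp continuous_subtype_val))) _
  have : setMul A B = (fun p : {p : G × G // dom p.1 = rng p.2} => p.1.1) ''
      (Φ ⁻¹' (Subtype.val ⁻¹' (A ×ˢ B))) := by
    ext x
    constructor
    · rintro ⟨a, ha, b, hb, h, rfl⟩
      refine ⟨⟨(comp a b h, inv b), by rw [dom_comp, rng_inv]⟩, ⟨?_, ?_⟩, rfl⟩
      · show comp (comp a b h) (inv b) _ ∈ A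
        rwa [comp_inv_cancel]
      · show inv (inv b) ∈ B
        rwa [inv_inv_arrow]
    · rintro ⟨⟨⟨x, y⟩, h⟩, ⟨h1, h2⟩, rfl⟩
      change comp x y h ∈ A at h1
      change inv y ∈ B at h2
      exact ⟨_, h1, _, h2, by rw [dom_comp, rng_inv],
        (comp_inv_cancel x y h (by rw [dom_comp, rng_inv])).symm⟩
  rw [this]
  exact hfst _ (((hA.prod hB).preimage continuous_subtype_val).preimage hΦ)

/-- Composability is an equation between identities, and that space is Hausdorff even if `G` is not.
So the composable pairs are closed and meet `A × B` in a compact set. -/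
theorem isCompact_setMul {A B : Set G} (hA : IsCompact A) (hB : IsCompact B) :
    IsCompact (setMul A B) := by
  have := IsBooleanGroupoid.t2_identities (G := G)
  have hcl : IsClosed {p : G × G | dom p.1 = rng p.2} := by
    have h1 : Continuous fun p : G × G => (⟨dom p.1, dom_mem_identities _⟩ : identities G) :=
      Continuous.subtype_mk (continuous_dom.comp continuous_fst) _
    have h2 : Continuous fun p : G × G => (⟨rng p.2, rng_mem_identities _⟩ : identities G) :=
      Continuous.subtype_mk (continuous_rng.comp continuous_snd) _
    have h3 := isClosed_eq h1 h2
    simpa only [Subtype.mk.injEq] using h3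
  have hK : IsCompact ((Subtype.val : {p : G × G // dom p.1 = rng p.2} → G × G) ⁻¹' (A ×ˢ B)) :=
    hcl.isClosedEmbedding_subtypeVal.isCompact_preimage (hA.prod hB)
  have : setMul A B = (fun p : {p : G × G // dom p.1 = rng p.2} => comp p.1.1 p.1.2 p.2) ''
      (Subtype.val ⁻¹' (A ×ˢ B)) := by
    ext x
    constructor
    · rintro ⟨a, ha, b, hb, h, rfl⟩
      exact ⟨⟨(a, b), h⟩, ⟨ha, hb⟩, rfl⟩
    · rintro ⟨⟨⟨a, b⟩, h⟩, ⟨ha, hb⟩, rfl⟩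
      exact ⟨a, ha, b, hb, h, rfl⟩
  rw [this]
  exact hK.image IsBooleanGroupoid.continuous_comp

/-- Compact sets need not be closed in `G`, but they are closed inside the Hausdorff space of
identities, which is open in `G`. -/
theorem isOpen_diff_of_subset_identities {E F : Set G} (hE : IsOpen E) (hEi : E ⊆ identities G)
    (hF : IsCompact F) (hFi : F ⊆ identities G) : IsOpen (E \ F) := by
  have := IsBooleanGroupoid.t2_identities (G := G)
  have hF' : IsCompact (Subtype.val ⁻¹' F : Set (identities G)) := by
    rw [Topology.IsInducing.subtypeVal.isCompact_preimage_iff]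
    · exact hF
    · rwa [Subtype.range_val]
  have h1 : IsOpen (Subtype.val ⁻¹' E \ Subtype.val ⁻¹' F : Set (identities G)) :=
    (hE.preimage continuous_subtype_val).sdiff hF'.isClosed
  have h2 := isOpen_identities.isOpenMap_subtype_val _ h1
  rwa [← Set.preimage_sdiff, Subtype.image_preimage_coe, Set.inter_eq_right.2] at h2
  exact fun x hx => hEi hx.1

/-- The compact-open sets of identities form a base at each identity. -/
theorem exists_compactOpen_identities {e : G} (he : e ∈ identities G) {W : Set G} (hW : IsOpen W)
    (heW : e ∈ W) : ∃ K, IsCompact K ∧ IsOpen K ∧ e ∈ K ∧ K ⊆ W ∧ K ⊆ identities G := by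
  have := IsBooleanGroupoid.t2_identities (G := G)
  have := IsBooleanGroupoid.locallyCompact_identities (G := G)
  obtain ⟨C, hC, hCW, hCc⟩ := LocallyCompactSpace.local_compact_nhds (⟨e, he⟩ : identities G) _
    ((hW.preimage continuous_subtype_val).mem_nhds heW)
  obtain ⟨s, hs, hes, hsC⟩ := IsBooleanGroupoid.zeroDim_identities (G := G)|>.mem_nhds_iff.1 hC
  refine ⟨Subtype.val '' s, ?_, isOpen_identities.isOpenMap_subtype_val _ hs.isOpen,
    ⟨_, hes, rfl⟩, ?_, ?_⟩
  · exact (hCc.of_isClosed_subset hs.isClosed hsC).image continuous_subtype_val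
  · rintro _ ⟨x, hx, rfl⟩
    exact hCW (hsC hx)
  · rintro _ ⟨x, _, rfl⟩
    exact x.2

/-- The compact-open local bisections form a base. -/
theorem exists_compactOpenBisection {g : G} {W : Set G} (hW : IsOpen W) (hg : g ∈ W) :
    ∃ U ∈ CompactOpenBisections G, g ∈ U ∧ U ⊆ W := by
  obtain ⟨e, hge, he⟩ := IsBooleanGroupoid.etale (G := G) g
  obtain ⟨f, hgf, hf⟩ := isLocalHomeomorph_rng (G := G) g
  -- Inside charts for both `dom` and `rng` every set is a local bisection; compactness is then
  -- arranged by cutting down to domains in a compact-open `K`.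
  have hUo : IsOpen (e.source ∩ f.source ∩ W) := (e.open_source.inter f.open_source).inter hW
  obtain ⟨K, hK, hKo, hgK, hKW, -⟩ := exists_compactOpen_identities (dom_mem_identities g)
    (isOpenMap_dom _ hUo) ⟨g, ⟨⟨hge, hgf⟩, hg⟩, rfl⟩
  have hinj : Set.InjOn dom (e.source ∩ f.source ∩ W) := by
    rw [he]
    exact e.injOn.mono fun x hx => hx.1.1
  have hKt : K ⊆ e.target := by
    intro x hx
    obtain ⟨y, hy, rfl⟩ := hKW hx
    rw [he]
    exact e.map_source hy.1.1
  -- The cut-down set is the image of `K` under the local section inverse to `dom`, hence compact.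
  have himg : e.source ∩ f.source ∩ W ∩ dom ⁻¹' K = e.symm '' K := by
    ext x
    constructor
    · rintro ⟨hx, hxK⟩
      refine ⟨dom x, hxK, ?_⟩
      rw [he]
      exact e.left_inv hx.1.1
    · rintro ⟨y, hy, rfl⟩
      obtain ⟨x, hx, rfl⟩ := hKW hy
      have : e.symm (dom x) = x := by
        rw [he]
        exact e.left_inv hx.1.1
      rw [this]
      exact ⟨hx, hy⟩
  refine ⟨e.source ∩ f.source ∩ W ∩ dom ⁻¹' K,
    ⟨?_, hUo.inter (hKo.preimage continuous_dom), ?_⟩, ⟨⟨⟨hge, hgf⟩, hg⟩, hgK⟩,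
    fun x hx => hx.1.2⟩
  · rw [himg]
    exact hK.image_of_continuousOn (e.continuousOn_symm.mono hKt)
  · rw [isLocalBisection_iff]
    refine ⟨?_, hinj.mono Set.inter_subset_left⟩
    rw [hf]
    exact f.injOn.mono fun x hx => hx.1.1.2

end Topology

/-! ## The Boolean inverse semigroup of compact-open local bisections -/

theorem exists_finite_subset_sUnion {X : Type u} [TopologicalSpace X] {K : Set X}
    (hK : IsCompact K) (P : Set (Set X)) (hP : ∀ U ∈ P, IsOpen U)
    (h : ∀ x ∈ K, ∃ U ∈ P, x ∈ U) : ∃ F ⊆ P, F.Finite ∧ K ⊆ ⋃₀ F := by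
  obtain ⟨F, hF, hFf, hKF⟩ := hK.elim_finite_subcover_image (b := P) (c := fun U => U) hP
    (fun x hx => by
      obtain ⟨U, hU, hxU⟩ := h x hx
      exact Set.mem_biUnion hU hxU)
  exact ⟨F, hF, hFf, by rwa [Set.sUnion_eq_biUnion]⟩

section Bisections

variable {G : Type u} [ArrowGroupoid G] [TopologicalSpace G] [IsBooleanGroupoid G]

/-- The type of compact-open local bisections. -/
def KB (G : Type u) [ArrowGroupoid G] [TopologicalSpace G] : Type u :=
  {U : Set G // U ∈ CompactOpenBisections G}

instance instInverseSemigroupBisections : InverseSemigroup (KB G) where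
  mul A B := ⟨setMul A.1 B.1, isCompact_setMul A.2.1 B.2.1, isOpen_setMul A.2.2.1 B.2.2.1,
    isLocalBisection_setMul A.2.2.2 B.2.2.2⟩
  mul_assoc A B C := Subtype.ext (setMul_assoc A.1 B.1 C.1)
  inv A := ⟨inv '' A.1, isCompact_inv A.2.1, isOpen_inv A.2.2.1, isLocalBisection_inv A.2.2.2⟩
  mul_inv_mul A := Subtype.ext (setMul_inv_mul A.2.2.2)
  inv_mul_inv A := Subtype.ext (by
    show setMul (setMul (inv '' A.1) A.1) (inv '' A.1) = inv '' A.1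
    conv_lhs => rw [← image_inv_image_inv A.1]
    rw [image_inv_image_inv (inv '' A.1)]
    exact setMul_inv_mul (isLocalBisection_inv A.2.2.2))
  inv_unique A B hA hB := Subtype.ext (by
    refine (subset_inv_of_regular B.2.2.2 (congrArg Subtype.val hB)).antisymm ?_
    have h := Set.image_mono (f := inv)
      (subset_inv_of_regular A.2.2.2 (congrArg Subtype.val hA))
    rwa [image_inv_image_inv] at h)

namespace KB

theorem coe_mul (A B : KB G) : (A * B).1 = setMul A.1 B.1 := rfl

theorem coe_inv (A : KB G) : (A⁻¹).1 = inv '' A.1 := rfl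

theorem isIdempotentElem_iff {E : KB G} :
    IsIdempotentElem E ↔ E.1 ⊆ identities G := by
  rw [← setMul_self_iff E.2.2.2, ← coe_mul]
  exact Subtype.ext_iff

theorem le_iff_subset {A B : KB G} : A ≤ B ↔ A.1 ⊆ B.1 := by
  constructor
  · rintro ⟨E, hE, rfl⟩
    exact setMul_identities_subset (isIdempotentElem_iff.1 hE)
  · intro h
    exact ⟨A⁻¹ * A, idem_inv_mul A, Subtype.ext (setMul_dom_of_subset h B.2.2.2).symm⟩

theorem isLUB_of_eq_union {A B C : KB G} (h : C.1 = A.1 ∪ B.1) :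
    IsLUB {A, B} C := by
  constructor
  · rintro X (rfl | rfl) <;> rw [le_iff_subset, h]
    · exact Set.subset_union_left
    · exact Set.subset_union_right
  · intro X hX
    rw [le_iff_subset, h]
    exact Set.union_subset (le_iff_subset.1 (hX (by simp))) (le_iff_subset.1 (hX (by simp)))

/-- Compatibility says that an arrow of `A` and one of `B` with equal domains, or equal ranges,
coincide, which is what the union needs to remain a bisection. -/
theorem exists_union {A B : KB G} (h : Compatible A B) :
    ∃ C : KB G, C.1 = A.1 ∪ B.1 := by
  have h1 := isIdempotentElem_iff.1 h.1
  have h2 := isIdempotentElem_iff.1 h.2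
  rw [coe_mul, coe_inv, setMul_subset_identities_left] at h1
  rw [coe_mul, coe_inv, setMul_subset_identities_right] at h2
  have hA := isLocalBisection_iff.1 A.2.2.2
  have hB := isLocalBisection_iff.1 B.2.2.2
  refine ⟨⟨A.1 ∪ B.1, A.2.1.union B.2.1, A.2.2.1.union B.2.2.1, isLocalBisection_iff.2 ⟨?_, ?_⟩⟩,
    rfl⟩
  · rintro x (hx | hx) y (hy | hy) hxy
    · exact hA.1 hx hy hxy
    · exact h1 x hx y hy hxy
    · exact (h1 y hy x hx hxy.symm).symm
    · exact hB.1 hx hy hxy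
  · rintro x (hx | hx) y (hy | hy) hxy
    · exact hA.2 hx hy hxy
    · exact h2 x hx y hy hxy
    · exact (h2 y hy x hx hxy.symm).symm
    · exact hB.2 hx hy hxy

theorem eq_union_of_isLUB {A B C : KB G} (hC : IsLUB {A, B} C) :
    C.1 = A.1 ∪ B.1 := by
  obtain ⟨D, hD⟩ := exists_union
    (compatible_of_le (hC.1 (by simp : A ∈ _)) (hC.1 (by simp : B ∈ _)))
  rw [hC.unique (isLUB_of_eq_union hD), hD]

end KB

instance instBooleanInverseSemigroupBisections :
    BooleanInverseSemigroup (KB G) where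
  zero := ⟨∅, isCompact_empty, isOpen_empty, isLocalBisection_iff.2 ⟨by simp, by simp⟩⟩
  zero_mul A := Subtype.ext (Set.eq_empty_of_forall_notMem fun _ ⟨_, ha, _⟩ => ha)
  mul_zero A := Subtype.ext (Set.eq_empty_of_forall_notMem fun _ ⟨_, _, _, hb, _⟩ => hb)
  exists_join A B h := by
    obtain ⟨C, hC⟩ := KB.exists_union h
    exact ⟨C, KB.isLUB_of_eq_union hC⟩
  mul_join X A B C _ h := KB.isLUB_of_eq_union (by
    rw [KB.coe_mul, KB.eq_union_of_isLUB h, setMul_union, KB.coe_mul, KB.coe_mul])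
  join_mul X A B C _ h := KB.isLUB_of_eq_union (by
    rw [KB.coe_mul, KB.eq_union_of_isLUB h, union_setMul, KB.coe_mul, KB.coe_mul])
  exists_sdiff E F hE hF := by
    have hEi := KB.isIdempotentElem_iff.1 hE
    have hFi := KB.isIdempotentElem_iff.1 hF
    refine ⟨⟨E.1 \ F.1, E.2.1.diff F.2.2.1,
      isOpen_diff_of_subset_identities E.2.2.1 hEi F.2.1 hFi,
      isLocalBisection_of_subset Set.sdiff_subset E.2.2.2⟩, ?_, ?_, ?_⟩
    · exact KB.isIdempotentElem_iff.2 fun x hx => hEi hx.1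
    · refine Subtype.ext (Set.eq_empty_of_forall_notMem ?_)
      rintro _ ⟨a, ha, b, hb, h, rfl⟩
      rw [show dom a = a from hFi ha, rng_of_mem (hEi hb.1)] at h
      exact hb.2 (h ▸ ha)
    · refine KB.isLUB_of_eq_union (Set.Subset.antisymm ?_ ?_)
      · intro x hx
        by_cases hxF : x ∈ F.1
        · exact .inl ⟨x, hx, x, hxF, (hEi hx).trans (rng_of_mem (hEi hx)).symm,
            (comp_identity (hEi hx) _).symm⟩
        · exact .inr ⟨hx, hxF⟩
      · exact Set.union_subset (setMul_identities_subset hFi) Set.sdiff_subset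

/-- A compact set covered by an open set is covered by finitely many compact-open local bisections
inside it. -/
theorem exists_finite_bisections {K W : Set G} (hK : IsCompact K) (hW : IsOpen W) (h : K ⊆ W) :
    ∃ F : Set (Set G), F.Finite ∧ F ⊆ CompactOpenBisections G ∧ (∀ U ∈ F, U ⊆ W) ∧
      K ⊆ ⋃₀ F := by
  obtain ⟨F, hF, hFf, hKF⟩ := exists_finite_subset_sUnion hK
    {U | U ∈ CompactOpenBisections G ∧ U ⊆ W} (fun U hU => hU.1.2.1) (fun g hg => by
      obtain ⟨U, hU, hgU, hUW⟩ := exists_compactOpenBisection hW (h hg)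
      exact ⟨U, ⟨hU, hUW⟩, hgU⟩)
  exact ⟨F, hFf, fun U hU => (hF hU).1, fun U hU => (hF hU).2, hKF⟩

end Bisections

/-! ## Covering functors -/

namespace CoveringHom

variable {G H : Type u} [ArrowGroupoid G] [TopologicalSpace G] [ArrowGroupoid H]
  [TopologicalSpace H]

theorem map_identities (φ : CoveringHom G H) {e : G} (he : e ∈ identities G) :
    φ.toFun e ∈ identities H := by
  show dom _ = _
  rw [← φ.map_dom, show dom e = e from he]

theorem map_inv (φ : CoveringHom G H) (g : G) : φ.toFun (inv g) = inv (φ.toFun g) := by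
  have h : dom (φ.toFun (inv g)) = rng (φ.toFun g) := by rw [← φ.map_dom, dom_inv, φ.map_rng]
  apply eq_inv_of_comp_mem h
  rw [← φ.map_comp (inv g) g (dom_inv g), inv_comp]
  exact φ.map_identities (dom_mem_identities g)

theorem eq_of_dom_eq (φ : CoveringHom G H) {g h : G} (hd : dom g = dom h)
    (hφ : φ.toFun g = φ.toFun h) : g = h :=
  (φ.star_bijective (dom g) (dom_mem_identities g)).injOn rfl hd.symm hφ

/-- Star injectivity handles domains directly; ranges reduce to domains by inversion. -/
theorem isLocalBisection_preimage (φ : CoveringHom G H) {A : Set H} (hA : IsLocalBisection A) :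
    IsLocalBisection (φ.toFun ⁻¹' A) := by
  rw [isLocalBisection_iff] at *
  constructor
  · intro x hx y hy hxy
    have h1 : φ.toFun x = φ.toFun y := hA.1 hx hy (by rw [← φ.map_rng, hxy, φ.map_rng])
    apply ArrowGroupoid.inv_injective
    apply φ.eq_of_dom_eq
    · rw [dom_inv, dom_inv, hxy]
    · rw [φ.map_inv, φ.map_inv, h1]
  · intro x hx y hy hxy
    exact φ.eq_of_dom_eq hxy (hA.2 hx hy (by rw [← φ.map_dom, hxy, φ.map_dom]))

/-- Given a factorization `a b` of the image of `g`, star surjectivity lifts `b` to some `k` with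
the domain of `g`, and `g k⁻¹` then lies over `a`. Mere functoriality gives only the other
inclusion. -/
theorem preimage_setMul (φ : CoveringHom G H) (A B : Set H) :
    φ.toFun ⁻¹' setMul A B = setMul (φ.toFun ⁻¹' A) (φ.toFun ⁻¹' B) := by
  ext g
  constructor
  · rintro ⟨a, ha, b, hb, h, hg⟩
    have hd : dom b = φ.toFun (dom g) := by rw [φ.map_dom, hg, dom_comp]
    obtain ⟨k, hk, rfl⟩ := (φ.star_bijective (dom g) (dom_mem_identities g)).surjOn hd
    have h1 : dom g = rng (inv k) := by rw [rng_inv]; exact (show dom k = dom g from hk).symm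
    have h2 : dom (ArrowGroupoid.comp g (ArrowGroupoid.inv k) h1) = rng k := by rw [dom_comp, dom_inv]
    refine ⟨ArrowGroupoid.comp g (ArrowGroupoid.inv k) h1, ?_, k, hb, h2, (comp_inv_cancel' g k h1 h2).symm⟩
    show φ.toFun _ ∈ A
    rw [φ.map_comp, comp_congr hg (φ.map_inv k) _ (by rw [dom_comp, rng_inv]), comp_inv_cancel]
    exact ha
  · rintro ⟨a, ha, b, hb, h, rfl⟩
    exact ⟨_, ha, _, hb, _, φ.map_comp a b h⟩

/-- A homeomorphic isomorphism of groupoids is a coherent, continuous covering functor. -/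
def ofHomeomorph (e : G ≃ₜ H) (hd : ∀ g, e (dom g) = dom (e g)) (hr : ∀ g, e (rng g) = rng (e g))
    (hc : ∀ g h (K : dom g = rng h), e (ArrowGroupoid.comp g h K) =
      ArrowGroupoid.comp (e g) (e h) (by rw [← hd, ← hr, K])) : CoveringHom G H where
  toFun := e
  map_dom := hd
  map_rng := hr
  map_comp := hc
  star_bijective x _ := by
    refine ⟨fun g hg => ?_, e.injective.injOn, fun h hh => ⟨e.symm h, ?_, by simp⟩⟩
    · show dom (e g) = e x
      rw [← hd, show dom g = x from hg]
    · apply e.injective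
      rw [hd, e.apply_symm_apply]
      exact hh
  continuous := e.continuous
  coherent U hU hUo := ⟨e.isCompact_preimage.2 hU, hUo.preimage e.continuous⟩

/-- The callitic morphism of taking inverse images of compact-open local bisections. -/
def toCallitic [IsBooleanGroupoid G] [IsBooleanGroupoid H] (φ : CoveringHom G H) :
    CalliticHom (KB H) (KB G) where
  toFun A := ⟨φ.toFun ⁻¹' A.1, (φ.coherent A.1 A.2.1 A.2.2.1).1, (φ.coherent A.1 A.2.1 A.2.2.1).2,
    φ.isLocalBisection_preimage A.2.2.2⟩
  map_mul A B := Subtype.ext (φ.preimage_setMul A.1 B.1)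
  map_zero := rfl
  map_join A B C _ h := KB.isLUB_of_eq_union (by
    show φ.toFun ⁻¹' C.1 = φ.toFun ⁻¹' A.1 ∪ φ.toFun ⁻¹' B.1
    rw [KB.eq_union_of_isLUB h, Set.preimage_union])
  proper t := by
    -- The image of each arrow of `t` lies in some bisection of `H`; shrink to bisections inside `t`
    -- and inside the preimages of these, then use compactness of `t`.
    obtain ⟨F, hF, hFb, hFs, hcov⟩ : ∃ F : Set (Set G), F.Finite ∧ F ⊆ CompactOpenBisections G ∧
        (∀ U ∈ F, U ⊆ t.1 ∧ ∃ s : KB H, U ⊆ φ.toFun ⁻¹' s.1) ∧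
        t.1 ⊆ ⋃₀ F := by
      obtain ⟨F, hF, hFf, hKF⟩ := exists_finite_subset_sUnion t.2.1
        {U | U ∈ CompactOpenBisections G ∧ U ⊆ t.1 ∧
          ∃ s : KB H, U ⊆ φ.toFun ⁻¹' s.1} (fun U hU => hU.1.2.1)
        (fun g hg => by
          obtain ⟨s, hs, hgs, -⟩ := exists_compactOpenBisection isOpen_univ
            (Set.mem_univ (φ.toFun g))
          obtain ⟨U, hU, hgU, hUW⟩ := exists_compactOpenBisection
            (t.2.2.1.inter (hs.2.1.preimage φ.continuous)) ⟨hg, hgs⟩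
          exact ⟨U, ⟨hU, fun x hx => (hUW hx).1, ⟨s, hs⟩, fun x hx => (hUW hx).2⟩, hgU⟩)
      exact ⟨F, hFf, fun U hU => (hF hU).1, fun U hU => (hF hU).2, hKF⟩
    refine ⟨Subtype.val ⁻¹' F, hF.preimage Subtype.val_injective.injOn, ⟨?_, ?_⟩, ?_⟩
    · intro U hU
      exact KB.le_iff_subset.2 (hFs _ hU).1
    · intro X hX
      refine KB.le_iff_subset.2 fun g hg => ?_
      obtain ⟨U, hU, hgU⟩ := hcov hg
      exact KB.le_iff_subset.1 (hX (show (⟨U, hFb hU⟩ : _) ∈ _ from hU)) hgU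
    · intro U hU
      obtain ⟨s, hs⟩ := (hFs _ hU).2
      exact ⟨s, KB.le_iff_subset.2 hs⟩
  weakly_meet A B t hA hB := by
    replace hA : t.1 ⊆ φ.toFun ⁻¹' A.1 := KB.le_iff_subset.1 hA
    replace hB : t.1 ⊆ φ.toFun ⁻¹' B.1 := KB.le_iff_subset.1 hB
    -- Without a Hausdorff assumption `A ∩ B` may fail to be compact, so it cannot serve as the
    -- meet. Only the compact image of `t` is covered, and the finite union stays a bisection
    -- because it lies in `A`.
    obtain ⟨F, hF, hFb, hFs, hcov⟩ := exists_finite_bisections (t.2.1.image φ.continuous)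
      (A.2.2.1.inter B.2.2.1) (by
        rintro _ ⟨g, hg, rfl⟩
        exact ⟨hA hg, hB hg⟩)
    have hsub : ⋃₀ F ⊆ A.1 ∩ B.1 := Set.sUnion_subset hFs
    refine ⟨⟨⋃₀ F, hF.isCompact_sUnion fun U hU => (hFb hU).1,
      isOpen_sUnion fun U hU => (hFb hU).2.1,
      isLocalBisection_of_subset (hsub.trans Set.inter_subset_left) A.2.2.2⟩, ?_, ?_, ?_⟩
    · exact KB.le_iff_subset.2 (hsub.trans Set.inter_subset_left)
    · exact KB.le_iff_subset.2 (hsub.trans Set.inter_subset_right)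
    · exact KB.le_iff_subset.2 fun g hg => hcov ⟨g, hg, rfl⟩

end CoveringHom

/-! ## Callitic morphisms -/

namespace CalliticHom

variable {S T : Type u} [BooleanInverseSemigroup S] [BooleanInverseSemigroup T]

theorem map_inv (θ : CalliticHom S T) (a : S) : θ.toFun a⁻¹ = (θ.toFun a)⁻¹ := by
  apply InverseSemigroup.inv_unique
  · rw [← θ.map_mul, ← θ.map_mul, mul_inv_mul]
  · rw [← θ.map_mul, ← θ.map_mul, inv_mul_inv]

/-- Properness and primeness give a member; weak meet preservation gives directedness. These are the
two places where a callitic morphism must be more than a morphism. -/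
theorem isPrimeFilter_preimage (θ : CalliticHom S T) {A : Set T} (hA : IsPrimeFilter A) :
    IsPrimeFilter (θ.toFun ⁻¹' A) where
  nonempty := by
    obtain ⟨t, ht⟩ := hA.nonempty
    obtain ⟨F, hF, hFt, hFs⟩ := θ.proper t
    obtain ⟨x, hx, hxA⟩ := hA.exists_mem_of_isLUB hF t ht hFt
    obtain ⟨s, hs⟩ := hFs x hx
    exact ⟨s, hA.upward x hxA _ hs⟩
  directed a ha b hb := by
    obtain ⟨t, ht, hta, htb⟩ := hA.directed _ ha _ hb
    obtain ⟨c, hca, hcb, htc⟩ := θ.weakly_meet a b t hta htb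
    exact ⟨c, hA.upward t ht _ htc, hca, hcb⟩
  upward a ha b hab := hA.upward _ ha _ (θ.monotone hab)
  zero_notMem := by
    show θ.toFun 0 ∉ A
    rw [θ.map_zero]
    exact hA.zero_notMem
  prime a b c hab hc hcA := by
    have h := θ.map_join a b c hab hc
    exact hA.prime _ _ _ (compatible_of_isLUB h) h hcA

/-- The action of a callitic morphism on prime filters. -/
def preimage (θ : CalliticHom S T) (A : StoneGroupoid T) : StoneGroupoid S :=
  ⟨θ.toFun ⁻¹' A.1, θ.isPrimeFilter_preimage A.2⟩

/-- Only one inclusion is checked, the other following from maximality of prime filters. -/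
theorem preimage_dom (θ : CalliticHom S T) (A : StoneGroupoid T) :
    θ.preimage (dom A) = dom (θ.preimage A) := by
  refine StoneGroupoid.ext (IsPrimeFilter.eq_of_subset (dom (θ.preimage A)).2
    (θ.preimage (dom A)).2 ?_).symm
  rintro x ⟨_, ⟨a, ha, rfl⟩, b, hb, h⟩
  refine ⟨(θ.toFun a)⁻¹, ⟨_, ha, rfl⟩, θ.toFun b, hb, ?_⟩
  rw [← θ.map_inv, ← θ.map_mul]
  exact θ.monotone h

theorem preimage_inv (θ : CalliticHom S T) (A : StoneGroupoid T) :
    θ.preimage (inv A) = inv (θ.preimage A) := by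
  refine StoneGroupoid.ext (Set.ext fun x => ?_)
  show θ.toFun x ∈ filterInv A.1 ↔ x ∈ filterInv (θ.toFun ⁻¹' A.1)
  rw [mem_filterInv, mem_filterInv, ← θ.map_inv]
  rfl

theorem preimage_rng (θ : CalliticHom S T) (A : StoneGroupoid T) :
    θ.preimage (rng A) = rng (θ.preimage A) := by
  rw [← dom_inv, θ.preimage_dom, θ.preimage_inv, dom_inv]

/-- The covering functor of taking inverse images of prime filters. -/
def toCovering (θ : CalliticHom S T) : CoveringHom (StoneGroupoid T) (StoneGroupoid S) where
  toFun := θ.preimage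
  map_dom := θ.preimage_dom
  map_rng := θ.preimage_rng
  map_comp A B h := by
    refine StoneGroupoid.ext (IsPrimeFilter.eq_of_subset
      (ArrowGroupoid.comp (θ.preimage A) (θ.preimage B) (by
        rw [← θ.preimage_dom, h, θ.preimage_rng])).2
      (θ.preimage (ArrowGroupoid.comp A B h)).2 ?_).symm
    · rintro x ⟨a, ha, b, hb, hx⟩
      refine ⟨θ.toFun a, ha, θ.toFun b, hb, ?_⟩
      rw [← θ.map_mul]
      exact θ.monotone hx
  star_bijective E hE := by
    refine ⟨fun A hA => ?_, fun A hA B hB h => ?_, fun C hC => ?_⟩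
    · show dom (θ.preimage A) = θ.preimage E
      rw [← θ.preimage_dom, show dom A = E from hA]
    -- Arrows with equal preimages share a member `θ.toFun a`, and arrows through a common element
    -- are determined by their domains.
    · obtain ⟨a, ha⟩ := (θ.preimage A).2.nonempty
      have hb : a ∈ (θ.preimage B).1 := h ▸ ha
      exact StoneGroupoid.injOn_dom_basic (θ.toFun a) ha hb
        ((show dom A = E from hA).trans (show dom B = E from hB).symm)
    -- The lift of `C` is the arrow through `θ.toFun c` with domain `E`; its preimage shares with
    -- `C` the member `c` and the domain.
    · obtain ⟨c, hc⟩ := C.2.nonempty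
      have h1 : c⁻¹ * c ∈ (θ.preimage E).1 := by
        rw [← show dom C = θ.preimage E from hC]
        exact IsFilter.inv_mul_mem_dom hc
      have h2 : E ∈ StoneGroupoid.basic ((θ.toFun c)⁻¹ * θ.toFun c) := by
        rw [← θ.map_inv, ← θ.map_mul]
        exact h1
      rw [← StoneGroupoid.image_dom_basic] at h2
      obtain ⟨A, hA, hAE⟩ := h2
      refine ⟨A, hAE, StoneGroupoid.injOn_dom_basic c hA hc ?_⟩
      rw [← θ.preimage_dom, hAE]
      exact hC.symm
  continuous := by
    rw [StoneGroupoid.isTopologicalBasis_basic.continuous_iff]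
    rintro _ ⟨a, rfl⟩
    exact StoneGroupoid.isOpen_basic (θ.toFun a)
  coherent U hU hUo := by
    obtain ⟨F, hF, hFf, hUF⟩ := exists_finite_subset_sUnion hU
      {V | V ∈ Set.range (StoneGroupoid.basic (S := S)) ∧ V ⊆ U}
      (fun V hV => StoneGroupoid.isTopologicalBasis_basic.isOpen hV.1)
      (fun A hA => by
        obtain ⟨V, hV, hAV, hVU⟩ :=
          StoneGroupoid.isTopologicalBasis_basic.exists_subset_of_mem_open hA hUo
        exact ⟨V, ⟨hV, hVU⟩, hAV⟩)
    have hU' : U = ⋃₀ F := hUF.antisymm (Set.sUnion_subset fun V hV => (hF hV).2)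
    rw [hU', Set.preimage_sUnion]
    constructor
    · refine hFf.isCompact_biUnion fun V hV => ?_
      obtain ⟨a, rfl⟩ := (hF hV).1
      exact StoneGroupoid.isCompact_basic (θ.toFun a)
    · refine isOpen_biUnion fun V hV => ?_
      obtain ⟨a, rfl⟩ := (hF hV).1
      exact StoneGroupoid.isOpen_basic (θ.toFun a)

/-- An isomorphism of semigroups is a callitic morphism. -/
def ofMulEquiv (e : S ≃* T) : CalliticHom S T := by
  have mono : ∀ {S T : Type u} [BooleanInverseSemigroup S] [BooleanInverseSemigroup T]
      (e : S ≃* T) {a b : S}, a ≤ b → e a ≤ e b := by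
    rintro S T _ _ e _ b ⟨f, hf, rfl⟩
    exact ⟨e f, by rw [IsIdempotentElem, ← _root_.map_mul, hf.eq], _root_.map_mul e b f⟩
  have hle : ∀ a b, e a ≤ e b ↔ a ≤ b := fun a b =>
    ⟨fun h => by simpa using mono e.symm h, fun h => mono e h⟩
  let o : S ≃o T := ⟨e.toEquiv, hle _ _⟩
  exact
  { toFun := e
    map_mul := _root_.map_mul e
    -- Multiplication determines the order, and zero is the least element.
    map_zero := eq_zero_of_le (by
      rw [← e.apply_symm_apply 0]
      exact mono e (zero_le'' _))
    map_join := fun a b c _ h => by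
      have := (OrderIso.isLUB_image' o).2 h
      rwa [Set.image_pair] at this
    proper := fun t => ⟨{t}, Set.finite_singleton t, isLUB_singleton, fun x _ =>
      ⟨e.symm x, by rw [e.apply_symm_apply]⟩⟩
    weakly_meet := fun a b t ha hb => ⟨e.symm t, by
      rw [← hle, e.apply_symm_apply]; exact ha, by
      rw [← hle, e.apply_symm_apply]; exact hb, by rw [e.apply_symm_apply]⟩ }

end CalliticHom

/-! ## Boolean inverse semigroups as compact-open local bisections -/

section Unit

variable {S : Type u} [BooleanInverseSemigroup S]

/-- The compact-open local bisection of all prime filters that contain `a`. -/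
def basicBisection (a : S) : KB (StoneGroupoid S) :=
  ⟨StoneGroupoid.basic a, StoneGroupoid.isCompact_basic a, StoneGroupoid.isOpen_basic a,
    isLocalBisection_iff.2 ⟨StoneGroupoid.injOn_rng_basic a, StoneGroupoid.injOn_dom_basic a⟩⟩

/-- Both products required for compatibility have basic sets inside `U⁻¹ U` or `U U⁻¹`, hence
consisting of identities, and such elements are idempotent. -/
theorem compatible_of_basic_subset {a b : S} {U : Set (StoneGroupoid S)}
    (hU : IsLocalBisection U) (ha : StoneGroupoid.basic a ⊆ U) (hb : StoneGroupoid.basic b ⊆ U) :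
    Compatible a b := by
  constructor
  · apply StoneGroupoid.idem_of_basic_subset
    rw [StoneGroupoid.basic_mul, StoneGroupoid.basic_inv]
    exact (setMul_mono (Set.image_mono ha) hb).trans hU.1
  · apply StoneGroupoid.idem_of_basic_subset
    rw [StoneGroupoid.basic_mul, StoneGroupoid.basic_inv]
    exact (setMul_mono ha (Set.image_mono hb)).trans hU.2

/-- Compact induction: locally a basic set fits inside `U`, and two such sets merge into the basic
set of a join, which exists because both lie in the bisection `U`. -/
theorem basicBisection_surjective : Function.Surjective (basicBisection (S := S)) := by
  intro U
  obtain ⟨a, haU, hUa⟩ : ∃ a, StoneGroupoid.basic a ⊆ U.1 ∧ U.1 ⊆ StoneGroupoid.basic a := by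
    refine U.2.1.induction_on
      (p := fun V => ∃ a, StoneGroupoid.basic a ⊆ U.1 ∧ V ⊆ StoneGroupoid.basic a) ?_ ?_ ?_ ?_
    · exact ⟨0, by simp [StoneGroupoid.basic_zero], Set.empty_subset _⟩
    · rintro V W hVW ⟨a, ha, hW⟩
      exact ⟨a, ha, hVW.trans hW⟩
    · rintro V W ⟨a, ha, hV⟩ ⟨b, hb, hW⟩
      obtain ⟨c, hc⟩ := BooleanInverseSemigroup.exists_join a b
        (compatible_of_basic_subset U.2.2.2 ha hb)
      refine ⟨c, ?_, ?_⟩ <;> rw [StoneGroupoid.basic_of_isLUB hc]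
      · exact Set.union_subset ha hb
      · exact Set.union_subset_union hV hW
    · intro A hA
      obtain ⟨_, ⟨a, rfl⟩, haA, haU⟩ :=
        StoneGroupoid.isTopologicalBasis_basic.exists_subset_of_mem_open hA U.2.2.1
      exact ⟨_, mem_nhdsWithin_of_mem_nhds ((StoneGroupoid.isOpen_basic a).mem_nhds haA), a, haU,
        le_rfl⟩
  exact ⟨a, Subtype.ext (haU.antisymm hUa)⟩

/-- A Boolean inverse semigroup is isomorphic to the semigroup of compact-open local bisections of
its Stone groupoid. -/
noncomputable def basicEquiv (S : Type u) [BooleanInverseSemigroup S] :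
    S ≃* KB (StoneGroupoid S) :=
  MulEquiv.ofBijective
    (⟨basicBisection, fun a b => Subtype.ext (StoneGroupoid.basic_mul a b)⟩ :
      S →ₙ* KB (StoneGroupoid S))
    ⟨fun _ _ h => StoneGroupoid.basic_injective (congrArg Subtype.val h),
      basicBisection_surjective⟩

end Unit

/-! ## Boolean groupoids as Stone groupoids -/

section Counit

variable {G : Type u} [ArrowGroupoid G] [TopologicalSpace G] [IsBooleanGroupoid G]

/-- The prime filter of all compact-open local bisections that contain `g`. -/
def pointFilter (g : G) : StoneGroupoid (KB G) :=
  ⟨{U | g ∈ U.1},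
  { nonempty := by
      obtain ⟨U, hU, hg, -⟩ := exists_compactOpenBisection isOpen_univ (Set.mem_univ g)
      exact ⟨⟨U, hU⟩, hg⟩
    directed := fun A hA B hB => by
      obtain ⟨U, hU, hg, hUW⟩ := exists_compactOpenBisection (A.2.2.1.inter B.2.2.1) ⟨hA, hB⟩
      exact ⟨⟨U, hU⟩, hg, KB.le_iff_subset.2 fun x hx => (hUW hx).1,
        KB.le_iff_subset.2 fun x hx => (hUW hx).2⟩
    upward := fun A hA B hB => KB.le_iff_subset.1 hB hA
    zero_notMem := fun h => h
    prime := fun A B C _ h hC => by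
      have hC' : g ∈ C.1 := hC
      rw [KB.eq_union_of_isLUB h] at hC'
      exact hC' }⟩

theorem mem_pointFilter {g : G} {U : KB G} : U ∈ (pointFilter g).1 ↔ g ∈ U.1 := Iff.rfl

theorem pointFilter_dom (g : G) : pointFilter (dom g) = dom (pointFilter g) := by
  refine StoneGroupoid.ext (IsPrimeFilter.eq_of_subset (dom (pointFilter g)).2
    (pointFilter (dom g)).2 ?_).symm
  rintro X ⟨_, ⟨A, hA, rfl⟩, B, hB, h⟩
  exact KB.le_iff_subset.1 h ⟨inv g, ⟨g, hA, rfl⟩, g, hB, dom_inv g, (inv_comp g).symm⟩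

theorem pointFilter_rng (g : G) : pointFilter (rng g) = rng (pointFilter g) := by
  refine StoneGroupoid.ext (IsPrimeFilter.eq_of_subset (rng (pointFilter g)).2
    (pointFilter (rng g)).2 ?_).symm
  rintro X ⟨A, hA, _, ⟨B, hB, rfl⟩, h⟩
  exact KB.le_iff_subset.1 h ⟨g, hA, inv g, ⟨g, hB, rfl⟩, (rng_inv g).symm, (comp_inv g).symm⟩

theorem pointFilter_comp (g h : G) (H : dom g = rng h) :
    pointFilter (ArrowGroupoid.comp g h H) = ArrowGroupoid.comp (pointFilter g) (pointFilter h)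
      (by rw [← pointFilter_dom, H, pointFilter_rng]) := by
  refine StoneGroupoid.ext (IsPrimeFilter.eq_of_subset
    (ArrowGroupoid.comp (pointFilter g) (pointFilter h) _).2 (pointFilter _).2 ?_).symm
  rintro X ⟨A, hA, B, hB, hX⟩
  exact KB.le_iff_subset.1 hX ⟨g, hA, h, hB, H, rfl⟩

/-- Since `G` need not be Hausdorff, the arrows are not separated directly: their domains are
separated in the space of identities, and a bisection containing both arrows has an injective domain
map. -/
theorem pointFilter_injective : Function.Injective (pointFilter (G := G)) := by
  have := IsBooleanGroupoid.t2_identities (G := G)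
  intro g h hgh
  have key : ∀ U : KB G, g ∈ U.1 → h ∈ U.1 := fun U hU => by
    rw [← mem_pointFilter, ← hgh]
    exact hU
  obtain ⟨U, hU, hgU, -⟩ := exists_compactOpenBisection isOpen_univ (Set.mem_univ g)
  refine (isLocalBisection_iff.1 hU.2.2).2 hgU (key ⟨U, hU⟩ hgU) ?_
  by_contra hne
  obtain ⟨V, W, hV, -, hgV, hhW, hVW⟩ := t2_separation
    (show (⟨dom g, dom_mem_identities g⟩ : identities G) ≠ ⟨dom h, dom_mem_identities h⟩ from
      fun H => hne (congrArg Subtype.val H))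
  obtain ⟨X, hX, hgX, hXV⟩ := exists_compactOpenBisection
    ((isOpen_identities.isOpenMap_subtype_val V hV).preimage continuous_dom)
    (show g ∈ dom ⁻¹' (Subtype.val '' V) from ⟨_, hgV, rfl⟩)
  obtain ⟨x, hxV, hx⟩ := hXV (key ⟨X, hX⟩ hgX)
  have hx' : x = ⟨dom h, dom_mem_identities h⟩ := Subtype.ext hx
  exact Set.disjoint_left.1 hVW hxV (hx' ▸ hhW)

/-- By maximality it suffices that `A` contains some point filter. Otherwise each point of a member
`U` has a bisection neighbourhood in `U` outside `A`; finitely many of these have join `U`,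
contradicting primeness. -/
theorem pointFilter_surjective : Function.Surjective (pointFilter (G := G)) := by
  intro A
  obtain ⟨U, hU⟩ := A.2.nonempty
  by_cases H : ∃ g, (pointFilter g).1 ⊆ A.1
  · obtain ⟨g, hg⟩ := H
    exact ⟨g, StoneGroupoid.ext (IsPrimeFilter.eq_of_subset (pointFilter g).2 A.2 hg)⟩
  exfalso
  push Not at H
  obtain ⟨F, hF, hFf, hUF⟩ := exists_finite_subset_sUnion U.2.1
    {V | ∃ h : V ∈ CompactOpenBisections G, V ⊆ U.1 ∧ (⟨V, h⟩ : KB G) ∉ A.1}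
    (fun V hV => hV.1.2.1) (fun g hg => by
      obtain ⟨W, hgW, hWA⟩ := Set.not_subset.1 (H g)
      obtain ⟨V, hV, hgV, hVW⟩ := exists_compactOpenBisection (W.2.2.1.inter U.2.2.1) ⟨hgW, hg⟩
      exact ⟨V, ⟨hV, fun x hx => (hVW hx).2, fun hVA => hWA (A.2.upward _ hVA W
        (KB.le_iff_subset.2 fun x hx => (hVW hx).1))⟩, hgV⟩)
  obtain ⟨V, hV, hVA⟩ := A.2.exists_mem_of_isLUB
    (hFf.preimage (Subtype.val_injective.injOn) : (Subtype.val ⁻¹' F : Set (KB G)).Finite) U hU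
    ⟨fun V hV => KB.le_iff_subset.2 (hF hV).2.1, fun X hX => KB.le_iff_subset.2 fun g hg => by
      obtain ⟨V, hV, hgV⟩ := hUF hg
      exact KB.le_iff_subset.1 (hX (show (⟨V, (hF hV).1⟩ : KB G) ∈ _ from hV)) hgV⟩
  exact (hF hV).2.2 hVA

theorem image_pointFilter (U : KB G) : pointFilter '' U.1 = StoneGroupoid.basic U := by
  apply Set.Subset.antisymm
  · rintro _ ⟨g, hg, rfl⟩
    exact hg
  · intro A hA
    obtain ⟨g, rfl⟩ := pointFilter_surjective A
    exact ⟨g, hA, rfl⟩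

/-- A Boolean groupoid is homeomorphic to the Stone groupoid of its semigroup of compact-open local
bisections. -/
noncomputable def pointHomeomorph (G : Type u) [ArrowGroupoid G] [TopologicalSpace G]
    [IsBooleanGroupoid G] : G ≃ₜ StoneGroupoid (KB G) :=
  (Equiv.ofBijective pointFilter
    ⟨pointFilter_injective, pointFilter_surjective⟩).toHomeomorphOfContinuousOpen
    (by
      rw [StoneGroupoid.isTopologicalBasis_basic.continuous_iff]
      rintro _ ⟨U, rfl⟩
      exact U.2.2.1)
    (by
      intro W hW
      rw [isOpen_iff_forall_mem_open]
      rintro _ ⟨g, hg, rfl⟩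
      obtain ⟨U, hU, hgU, hUW⟩ := exists_compactOpenBisection hW hg
      refine ⟨StoneGroupoid.basic (⟨U, hU⟩ : KB G), ?_, StoneGroupoid.isOpen_basic _, hgU⟩
      exact (image_pointFilter ⟨U, hU⟩).symm.subset.trans (Set.image_mono hUW))

theorem pointHomeomorph_apply (g : G) : pointHomeomorph G g = pointFilter g := rfl

end Counit

/-! ## The dual equivalence -/

/-- The functor that sends a Boolean inverse semigroup to its Stone groupoid. -/
def stoneFunctor : BoolInvSemigrp.{u}ᵒᵖ ⥤ BoolGrpd.{u} where
  obj S := ⟨StoneGroupoid S.unop.carrier⟩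
  map θ := CalliticHom.toCovering θ.unop

/-- The functor that sends a Boolean groupoid to its compact-open local bisections. -/
def bisectionFunctor : BoolGrpd.{u} ⥤ BoolInvSemigrp.{u}ᵒᵖ where
  obj G := Opposite.op ⟨KB G.carrier⟩
  map φ := Quiver.Hom.op (CoveringHom.toCallitic φ)

/-- The isomorphism `S ≅ KB(G(S))`. -/
noncomputable def unitComponent (S : BoolInvSemigrp.{u}) :
    S ≅ (⟨KB (StoneGroupoid S.carrier)⟩ : BoolInvSemigrp.{u}) where
  hom := CalliticHom.ofMulEquiv (basicEquiv S.carrier)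
  inv := CalliticHom.ofMulEquiv (basicEquiv S.carrier).symm
  hom_inv_id := CalliticHom.ext (funext (basicEquiv S.carrier).symm_apply_apply)
  inv_hom_id := CalliticHom.ext (funext (basicEquiv S.carrier).apply_symm_apply)

/-- The isomorphism `G ≅ G(KB(G))`. -/
noncomputable def counitComponent (G : BoolGrpd.{u}) :
    G ≅ (⟨StoneGroupoid (KB G.carrier)⟩ : BoolGrpd.{u}) where
  hom := CoveringHom.ofHomeomorph (pointHomeomorph G.carrier) pointFilter_dom pointFilter_rng
    pointFilter_comp
  inv := CoveringHom.ofHomeomorph (pointHomeomorph G.carrier).symm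
    (fun A => by
      rw [Homeomorph.symm_apply_eq, pointHomeomorph_apply, pointFilter_dom,
        ← pointHomeomorph_apply, Homeomorph.apply_symm_apply])
    (fun A => by
      rw [Homeomorph.symm_apply_eq, pointHomeomorph_apply, pointFilter_rng,
        ← pointHomeomorph_apply, Homeomorph.apply_symm_apply])
    (fun A B h => by
      rw [Homeomorph.symm_apply_eq, pointHomeomorph_apply, pointFilter_comp]
      apply comp_congr
      · rw [← pointHomeomorph_apply, Homeomorph.apply_symm_apply]
      · rw [← pointHomeomorph_apply, Homeomorph.apply_symm_apply])
  hom_inv_id := CoveringHom.ext (funext (pointHomeomorph G.carrier).symm_apply_apply)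
  inv_hom_id := CoveringHom.ext (funext (pointHomeomorph G.carrier).apply_symm_apply)

/-- Non-commutative Stone duality. -/
noncomputable def stoneEquivalence : BoolInvSemigrp.{u}ᵒᵖ ≌ BoolGrpd.{u} :=
  -- Naturality is definitional: for the unit both paths give `{A | θ a ∈ A}`, for the counit `{U |
  -- φ g ∈ U}`. Any adjustment needed for the triangle identities leaves the two functors unchanged.
  CategoryTheory.Equivalence.mk stoneFunctor bisectionFunctor
    (NatIso.ofComponents (F := stoneFunctor ⋙ bisectionFunctor) (G := 𝟭 BoolInvSemigrp.{u}ᵒᵖ)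
      (fun S => (unitComponent S.unop).op) (fun _ => rfl)).symm
    (NatIso.ofComponents (F := 𝟭 BoolGrpd.{u}) (G := bisectionFunctor ⋙ stoneFunctor)
      counitComponent (fun _ => rfl)).symm

theorem isStoneFunctor_stoneFunctor : IsStoneFunctor stoneFunctor.{u} := by
  refine ⟨fun S => Equiv.refl _, fun S => ?_, fun S T θ g => rfl⟩
  refine ⟨fun _ => rfl, fun _ => rfl, fun _ => rfl, fun _ _ _ => rfl, ?_⟩
  have h : {U : Set (StoneGroupoid S.carrier) | ∃ a, U = {A | a ∈ A.1}} =
      Set.range StoneGroupoid.basic := Set.ext fun U => exists_congr fun a => eq_comm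
  exact h.symm ▸ StoneGroupoid.isTopologicalBasis_basic (S := S.carrier)

theorem isBisectionFunctor_bisectionFunctor : IsBisectionFunctor bisectionFunctor.{u} :=
  ⟨fun _ => Equiv.refl _, fun _ _ _ => rfl, fun _ _ _ _ => rfl⟩

end NCStone

theorem theorem7 :
    ∃ e : NCStone.BoolInvSemigrp.{u}ᵒᵖ ≌ NCStone.BoolGrpd.{u},
      NCStone.IsStoneFunctor e.functor ∧ NCStone.IsBisectionFunctor e.inverse :=
  ⟨NCStone.stoneEquivalence, NCStone.isStoneFunctor_stoneFunctor,
    NCStone.isBisectionFunctor_bisectionFunctor⟩
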